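/- Let $\pi\colon E\to M$ be a smooth fibration (surjective submersion, for instance a fibre bundle), $\dim M=m$, $\dim E=m+n$, with $M$ Hausdorff. Let $J^1\pi$ be its first jet manifold, consisting of the linear maps $z\colon T_{\pi(p)}M\to T_pE$ with $T_p\pi\circ z=\mathrm{id}$, $p\in E$, with projections $\pi_{1,0}\colon J^1\pi\to E$ (which is an affine bundle) and $\pi_1\colon J^1\pi\to M$, and let $J^1\pi_1$ be the first jet manifold of $\pi_1$. Adapted coordinates $(x^i,u^\alpha)$ of $\pi$ induce coordinates $(x^i,u^\alpha,u^\alpha_i)$ on $J^1\pi$, with $u^\alpha_i(j^1_x\phi)=\partial\phi^\alpha/\partial x^i$, and $(x^i,u^\alpha,u^\alpha_i,\bar u^\alpha_j,u^\alpha_{ij})$ on $J^1\pi_1$, with $\bar u^\alpha_j(j^1_x\sigma)=\partial(u^\alpha\circ\sigma)/\partial x^j$ and $u^\alpha_{ij}(j^1_x\sigma)=\partial(u^\alpha_i\circ\sigma)/\partial x^j$. The manifold $J^1\pi_1$ has two affine structures over $J^1\pi$: that of the jet bundle $(\pi_1)_{1,0}\colon J^1\pi_1\to J^1\pi$, $j^1_x\sigma\mapsto\sigma(x)$,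 and that of the prolongation $j^1(\pi_{1,0})\colon J^1\pi_1\to J^1\pi$, $j^1_x\sigma\mapsto j^1_x(\pi_{1,0}\circ\sigma)$, whose affine combinations are $(1-t)\,j^1_x\sigma_0+t\,j^1_x\sigma_1=j^1_x((1-t)\sigma_0+t\sigma_1)$ for local sections $\sigma_0,\sigma_1$ of $\pi_1$ with $\pi_{1,0}\circ\sigma_0=\pi_{1,0}\circ\sigma_1$. Let $\nabla$ be an arbitrary smooth linear connection on $M$, with Christoffel symbols $\nabla_{\partial/\partial x^i}\,\partial/\partial x^j=\Gamma^k_{ij}\,\partial/\partial x^k$ and torsion tensor $T(X,Y)=\nabla_XY-\nabla_YX-[X,Y]$, and let $\nabla+T$ be the connection $(\nabla+T)_XY=\nabla_XY+T(Y,X)$. Then there is exactly one map $ex_\nabla\colon J^1\pi_1\to J^1\pi_1$ which has, in all coordinates induced by adapted coordinates of $\pi$, the expression $$ex_\nabla(x^i,u^\alpha,u^\alpha_i,\bar u^\alpha_j,u^\alpha_{ij})=\bigl(x^i,u^\alpha,\bar u^\alpha_i,u^\alpha_j,u^\alpha_{ji}+(\bar u^\alpha_k-u^\alpha_k)\Gamma^k_{ji}\bigr).$$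 Moreover: 1. $ex_\nabla$ is a diffeomorphism, it satisfies $j^1(\pi_{1,0})\circ ex_\nabla=(\pi_1)_{1,0}$ and $(\pi_1)_{1,0}\circ ex_\nabla=j^1(\pi_{1,0})$, and it carries the affine structure of the fibres of $(\pi_1)_{1,0}$ to that of the fibres of $j^1(\pi_{1,0})$ and vice versa; that is, it is an isomorphism of affine bundles over the identity of $J^1\pi$ that exchanges both affine structures. Its inverse is $ex_{\nabla+T}$. 2. If $n\ge1$, then $ex_\nabla\circ ex_\nabla=\mathrm{id}$ if and only if $\nabla$ is symmetric, i.e. $T=0$. -/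

import Mathlib

open Set Filter Topology
open scoped Manifold ContDiff

noncomputable section

namespace JetExchange

set_option linter.unusedSectionVars false

universe uX uF uM uE

section Charts

variable {V : Type*} [NormedAddCommGroup V] [NormedSpace ℝ V]
  {N : Type*} [TopologicalSpace N] [ChartedSpace V N]

/-- The differential `T_p N → V` of a `V`-valued chart `e` of a manifold `N`. -/
def chartDeriv (e : OpenPartialHomeomorph N V) (p : N) :
    TangentSpace 𝓘(ℝ, V) p →L[ℝ] V :=
  mfderiv 𝓘(ℝ, V) 𝓘(ℝ, V) e p

variable [IsManifold 𝓘(ℝ, V) ∞ N] {e e' : OpenPartialHomeomorph N V}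

theorem mdifferentiable_of_mem_maximalAtlas
    (he : e ∈ IsManifold.maximalAtlas 𝓘(ℝ, V) ∞ N) :
    e.MDifferentiable 𝓘(ℝ, V) 𝓘(ℝ, V) :=
  ⟨(contMDiffOn_of_mem_maximalAtlas he).mdifferentiableOn (by simp),
    (contMDiffOn_symm_of_mem_maximalAtlas he).mdifferentiableOn (by simp)⟩

theorem isInvertible_chartDeriv (he : e ∈ IsManifold.maximalAtlas 𝓘(ℝ, V) ∞ N)
    {p : N} (hp : p ∈ e.source) : (chartDeriv e p).IsInvertible :=
  ⟨(mdifferentiable_of_mem_maximalAtlas he).mfderiv hp, rfl⟩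

theorem contDiffOn_transition (he : e ∈ IsManifold.maximalAtlas 𝓘(ℝ, V) ∞ N)
    (he' : e' ∈ IsManifold.maximalAtlas 𝓘(ℝ, V) ∞ N) :
    ContDiffOn ℝ ∞ (e' ∘ e.symm) (e.symm ≫ₕ e').source := by
  rw [← contMDiffOn_iff_contDiffOn]
  exact (contMDiffOn_of_mem_maximalAtlas he').comp
    ((contMDiffOn_symm_of_mem_maximalAtlas he).mono (by simp [inter_subset_left]))
    (by intro y hy; simpa using hy.2)

theorem chartDeriv_comp_inverse (he : e ∈ IsManifold.maximalAtlas 𝓘(ℝ, V) ∞ N)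
    (he' : e' ∈ IsManifold.maximalAtlas 𝓘(ℝ, V) ∞ N) {p : N} (hp : p ∈ e.source)
    (hp' : p ∈ e'.source) :
    (chartDeriv e' p).comp (chartDeriv e p).inverse = fderiv ℝ (e' ∘ e.symm) (e p) := by
  have hd := mdifferentiable_of_mem_maximalAtlas he
  have hd' := mdifferentiable_of_mem_maximalAtlas he'
  have h1 : MDifferentiableAt 𝓘(ℝ, V) 𝓘(ℝ, V) (e' ∘ e.symm) (e p) := by
    refine MDifferentiableAt.comp (I' := 𝓘(ℝ, V)) (e p) ?_ (hd.mdifferentiableAt_symm (e.map_source hp))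
    rw [e.left_inv hp]; exact hd'.mdifferentiableAt hp'
  have h2 : (fderiv ℝ (e' ∘ e.symm) (e p)).comp (chartDeriv e p) = chartDeriv e' p := by
    rw [← mfderiv_eq_fderiv]
    have h3 := mfderiv_comp p h1 (hd.mdifferentiableAt hp)
    have h4 : (e' ∘ e.symm) ∘ e =ᶠ[𝓝 p] e' := by
      filter_upwards [e.open_source.mem_nhds hp] with q hq
      simp [e.left_inv hq]
    rw [h4.mfderiv_eq] at h3
    exact h3.symm
  rw [← h2, ContinuousLinearMap.comp_assoc,
    (isInvertible_chartDeriv he hp).self_comp_inverse, ContinuousLinearMap.comp_id]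

end Charts

section General

variable (X : Type uX) (F : Type uF) [NormedAddCommGroup X] [NormedSpace ℝ X]
  [NormedAddCommGroup F] [NormedSpace ℝ F]
  {M : Type uM} {E : Type uE} [TopologicalSpace M] [ChartedSpace X M]
  [TopologicalSpace E] [ChartedSpace (X × F) E]

/-- `π : E → M` is a smooth fibration (a surjective submersion); `M` is modelled on `X` and `E`
on `X × F`, so that the fibres are modelled on `F`. -/
class IsFibration (π : E → M) : Prop where
  surjective : Function.Surjective π
  isSubmersion : Manifold.IsSubmersionOfComplement F 𝓘(ℝ, X × F) 𝓘(ℝ, X) ∞ π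

/-- The first jets at `p` : the linear maps `z : T_{π p} M → T_p E` with `T_p π ∘ z = id`. -/
structure JetFiber (π : E → M) (p : E) where
  lin : TangentSpace 𝓘(ℝ, X) (π p) →L[ℝ] TangentSpace 𝓘(ℝ, X × F) p
  isSection : (mfderiv 𝓘(ℝ, X × F) 𝓘(ℝ, X) π p).comp lin = ContinuousLinearMap.id ℝ _

/-- The first jet manifold `J¹π`, as a set: the disjoint union of the sets of jets at the points
of `E`. -/
structure Jet1 (π : E → M) where
  /-- The projection `π_{1,0} : J¹π → E`. -/
  pt : E
  jet : JetFiber X F π pt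

/-- Adapted (fibred) coordinates `(xⁱ, u^α)` of `π`: a smooth chart `(xⁱ)` of `M` and a smooth
chart of `E` which lies over it, and whose first component is `xⁱ ∘ π`. -/
structure FiberedChart (π : E → M) where
  base : OpenPartialHomeomorph M X
  total : OpenPartialHomeomorph E (X × F)
  base_mem : base ∈ IsManifold.maximalAtlas 𝓘(ℝ, X) ∞ M
  total_mem : total ∈ IsManifold.maximalAtlas 𝓘(ℝ, X × F) ∞ E
  mapsTo : ∀ p ∈ total.source, π p ∈ base.source
  fst_eq : ∀ p ∈ total.source, (total p).1 = base (π p)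

variable {X F} {π : E → M}

namespace JetFiber

@[ext]
theorem ext {p : E} {a b : JetFiber X F π p} (h : a.lin = b.lin) : a = b := by
  cases a; cases b; congr

/-- The point `(1 - t) a + t b` of the affine space of jets at `p`. -/
def lineMap {p : E} (a b : JetFiber X F π p) (t : ℝ) : JetFiber X F π p where
  lin := (1 - t) • a.lin + t • b.lin
  isSection := by
    rw [ContinuousLinearMap.comp_add, ContinuousLinearMap.comp_smul,
      ContinuousLinearMap.comp_smul, a.isSection, b.isSection, ← add_smul]
    simp

end JetFiber

variable [IsManifold 𝓘(ℝ, X) ∞ M] [IsManifold 𝓘(ℝ, X × F) ∞ E]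

namespace IsFibration

theorem contMDiff [IsFibration X F π] : ContMDiff 𝓘(ℝ, X × F) 𝓘(ℝ, X) ∞ π :=
  (IsFibration.isSubmersion (X := X) (F := F) (π := π)).contMDiff

theorem mdifferentiableAt [IsFibration X F π] (p : E) :
    MDifferentiableAt 𝓘(ℝ, X × F) 𝓘(ℝ, X) π p :=
  (contMDiff (F := F) p).mdifferentiableAt (by simp)

/-- A linear change of coordinates of a chart is a chart. -/
theorem trans_mem_maximalAtlas {V : Type*} [NormedAddCommGroup V] [NormedSpace ℝ V]
    {N : Type*} [TopologicalSpace N] [ChartedSpace V N] [IsManifold 𝓘(ℝ, V) ∞ N]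
    {e : OpenPartialHomeomorph N V} (he : e ∈ IsManifold.maximalAtlas 𝓘(ℝ, V) ∞ N)
    (L : V ≃L[ℝ] V) :
    e ≫ₕ L.toHomeomorph.toOpenPartialHomeomorph ∈ IsManifold.maximalAtlas 𝓘(ℝ, V) ∞ N := by
  have hL : ∀ L : V ≃L[ℝ] V, L.toHomeomorph.toOpenPartialHomeomorph ∈
      contDiffGroupoid ∞ 𝓘(ℝ, V) := fun L => by
    rw [contDiffGroupoid, mem_groupoid_of_pregroupoid]
    exact ⟨by simpa [contDiffPregroupoid] using! L.contDiff.contDiffOn,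
      by simpa [contDiffPregroupoid] using! L.symm.contDiff.contDiffOn⟩
  intro e' he'
  obtain ⟨h1, h2⟩ := he e' he'
  refine ⟨?_, ?_⟩
  · rw [OpenPartialHomeomorph.trans_symm_eq_symm_trans_symm, OpenPartialHomeomorph.trans_assoc]
    exact StructureGroupoid.trans _ (StructureGroupoid.symm _ (hL L)) h1
  · rw [← OpenPartialHomeomorph.trans_assoc]
    exact StructureGroupoid.trans _ h2 (hL L)

theorem exists_fiberedChart [IsFibration X F π] (p : E) :
    ∃ c : FiberedChart X F π, p ∈ c.total.source := by
  have h := IsFibration.isSubmersion (X := X) (F := F) (π := π) p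
  refine ⟨⟨h.codChart, h.domChart ≫ₕ h.equiv.toHomeomorph.toOpenPartialHomeomorph,
    h.codChart_mem_maximalAtlas, trans_mem_maximalAtlas h.domChart_mem_maximalAtlas _, ?_, ?_⟩, ?_⟩
  · intro q hq
    exact h.source_subset_preimage_source (by simpa using hq)
  · intro q hq
    have hq' : q ∈ h.domChart.source := by simpa using hq
    have hq'' : h.domChart q ∈ (h.domChart.extend 𝓘(ℝ, X × F)).target := by
      simpa using h.domChart.map_source hq'
    have := h.writtenInCharts hq''
    simp [h.domChart.left_inv hq'] at this
    simpa using this.symm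
  · simpa using h.mem_domChart_source

end IsFibration

namespace FiberedChart

variable (c c' : FiberedChart X F π)

theorem base_comp_deriv [IsFibration X F π] {p : E} (hp : p ∈ c.total.source) :
    (chartDeriv c.base (π p)).comp (mfderiv 𝓘(ℝ, X × F) 𝓘(ℝ, X) π p) =
      (ContinuousLinearMap.fst ℝ X F).comp (chartDeriv c.total p) := by
  have h1 := mfderiv_comp p
    ((mdifferentiable_of_mem_maximalAtlas c.base_mem).mdifferentiableAt (c.mapsTo p hp))
    (IsFibration.mdifferentiableAt (X := X) (F := F) p)
  have h2 := mfderiv_comp p (I'' := 𝓘(ℝ, X)) (g := ContinuousLinearMap.fst ℝ X F)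
    (ContinuousLinearMap.mdifferentiableAt _)
    ((mdifferentiable_of_mem_maximalAtlas c.total_mem).mdifferentiableAt hp)
  have h3 : c.base ∘ π =ᶠ[𝓝 p] (ContinuousLinearMap.fst ℝ X F) ∘ c.total := by
    filter_upwards [c.total.open_source.mem_nhds hp] with q hq
    simp [c.fst_eq q hq]
  rw [h3.mfderiv_eq, h2, ContinuousLinearMap.mfderiv_eq] at h1
  exact h1.symm

/-- The coordinates `u^α_i` of a jet, as a linear map. For `z = j¹_x φ` this is the differential
of `φ^α` with respect to the coordinates `xⁱ`. -/
def slope {p : E} (z : JetFiber X F π p) : X →L[ℝ] F :=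
  (ContinuousLinearMap.snd ℝ X F).comp
    ((chartDeriv c.total p).comp (z.lin.comp (chartDeriv c.base (π p)).inverse))

/-- The jet at `p` with coordinates `w`. -/
def ofSlope [IsFibration X F π] (p : E) (hp : p ∈ c.total.source) (w : X →L[ℝ] F) :
    JetFiber X F π p where
  lin := (chartDeriv c.total p).inverse.comp
    (((ContinuousLinearMap.id ℝ X).prod w).comp (chartDeriv c.base (π p)))
  isSection := by
    have hb := isInvertible_chartDeriv c.base_mem (c.mapsTo p hp)
    have ht := isInvertible_chartDeriv c.total_mem hp
    ext v
    apply hb.injective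
    have := congrArg (fun L => L ((chartDeriv c.total p).inverse
      (((ContinuousLinearMap.id ℝ X).prod w) (chartDeriv c.base (π p) v)))) (c.base_comp_deriv hp)
    simpa [ht.self_apply_inverse] using! this

theorem slope_ofSlope [IsFibration X F π] (p : E) (hp : p ∈ c.total.source) (w : X →L[ℝ] F) :
    c.slope (c.ofSlope p hp w) = w := by
  have hb := isInvertible_chartDeriv c.base_mem (c.mapsTo p hp)
  have ht := isInvertible_chartDeriv c.total_mem hp
  ext v
  simp [slope, ofSlope, hb.self_apply_inverse, ht.self_apply_inverse]

theorem total_lin [IsFibration X F π] {p : E} (hp : p ∈ c.total.source) (z : JetFiber X F π p)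
    (v : TangentSpace 𝓘(ℝ, X) (π p)) :
    (chartDeriv c.total p (z.lin v)).1 = chartDeriv c.base (π p) v := by
  have h1 := congrArg (fun L => L (z.lin v)) (c.base_comp_deriv hp)
  have h2 := congrArg (fun L => L v) z.isSection
  have h3 : mfderiv 𝓘(ℝ, X × F) 𝓘(ℝ, X) π p (z.lin v) = v := h2
  have h4 : chartDeriv c.base (π p) (mfderiv 𝓘(ℝ, X × F) 𝓘(ℝ, X) π p (z.lin v)) =
    (chartDeriv c.total p (z.lin v)).1 := h1
  rw [← h4, h3]

theorem ofSlope_slope [IsFibration X F π] (p : E) (hp : p ∈ c.total.source)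
    (z : JetFiber X F π p) : c.ofSlope p hp (c.slope z) = z := by
  have hb := isInvertible_chartDeriv c.base_mem (c.mapsTo p hp)
  have ht := isInvertible_chartDeriv c.total_mem hp
  ext1
  ext1 v
  apply ht.injective
  have h := c.total_lin hp z v
  apply Prod.ext <;>
  simp [slope, ofSlope, hb.inverse_apply_self, ht.self_apply_inverse, h]

/-- The induced coordinates `(xⁱ, (u^α, u^α_i))` on `J¹π`. -/
def jetCoord (z : Jet1 X F π) : X × (F × (X →L[ℝ] F)) :=
  (c.base (π z.pt), ((c.total z.pt).2, c.slope z.jet))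

end FiberedChart

theorem nonempty_jetFiber [IsFibration X F π] (p : E) : Nonempty (JetFiber X F π p) := by
  obtain ⟨c, hc⟩ := IsFibration.exists_fiberedChart (X := X) (F := F) (π := π) p
  exact ⟨c.ofSlope p hc 0⟩

namespace FiberedChart

variable (c c' : FiberedChart X F π) [IsFibration X F π]

open Classical in
/-- The jet with given coordinates, the inverse of `jetCoord`. -/
def jetOfCoord (y : X × (F × (X →L[ℝ] F))) : Jet1 X F π :=
  if h : c.total.symm (y.1, y.2.1) ∈ c.total.source then
    ⟨_, c.ofSlope _ h y.2.2⟩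
  else ⟨c.total.symm (y.1, y.2.1), (nonempty_jetFiber _).some⟩

theorem jetOfCoord_pt (y : X × (F × (X →L[ℝ] F))) :
    (c.jetOfCoord y).pt = c.total.symm (y.1, y.2.1) := by
  unfold jetOfCoord; split_ifs <;> rfl

theorem jetOfCoord_of_mem {y : X × (F × (X →L[ℝ] F))}
    (h : c.total.symm (y.1, y.2.1) ∈ c.total.source) :
    c.jetOfCoord y = ⟨_, c.ofSlope _ h y.2.2⟩ :=
  dif_pos h

theorem mk_ofSlope_congr {p q : E} (h : p = q) (hp : p ∈ c.total.source)
    (hq : q ∈ c.total.source) (w : X →L[ℝ] F) :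
    (⟨p, c.ofSlope p hp w⟩ : Jet1 X F π) = ⟨q, c.ofSlope q hq w⟩ := by
  subst h; rfl

theorem jetCoord_jetOfCoord {y : X × (F × (X →L[ℝ] F))}
    (hy : (y.1, y.2.1) ∈ c.total.target) : c.jetCoord (c.jetOfCoord y) = y := by
  have h := c.total.map_target hy
  have h' := c.fst_eq _ h
  rw [c.total.right_inv hy] at h'
  rw [c.jetOfCoord_of_mem h]
  simp only [jetCoord, slope_ofSlope, c.total.right_inv hy, ← h']

theorem jetOfCoord_jetCoord {z : Jet1 X F π} (hz : z.pt ∈ c.total.source) :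
    c.jetOfCoord (c.jetCoord z) = z := by
  obtain ⟨p, z⟩ := z
  have h0 : (c.base (π p), (c.total p).2) = c.total p := by
    rw [← c.fst_eq p hz]
  have h1 : c.total.symm (c.base (π p), (c.total p).2) = p := by
    rw [h0, c.total.left_inv hz]
  have h2 : c.total.symm (c.base (π p), (c.total p).2) ∈ c.total.source := by rwa [h1]
  rw [c.jetOfCoord_of_mem h2]
  exact (c.mk_ofSlope_congr h1 h2 hz _).trans (by rw [jetCoord, ofSlope_slope])

/-- The induced coordinates on `J¹π` as a partial bijection; its domain consists of the jets at the
points of the domain of the coordinates of `E`. -/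
def jetPartialEquiv : PartialEquiv (Jet1 X F π) (X × (F × (X →L[ℝ] F))) where
  toFun := c.jetCoord
  invFun := c.jetOfCoord
  source := {z | z.pt ∈ c.total.source}
  target := {y | (y.1, y.2.1) ∈ c.total.target}
  map_source' z hz := by
    have := c.total.map_source hz
    rwa [← Prod.mk.eta (p := c.total z.pt), c.fst_eq _ hz] at this
  map_target' y hy := by
    simpa [jetOfCoord_pt] using c.total.map_target hy
  left_inv' _ hz := c.jetOfCoord_jetCoord hz
  right_inv' _ hy := c.jetCoord_jetOfCoord hy

/-- The change of coordinates `v^β_j = (∂v^β/∂xⁱ + u^α_i ∂v^β/∂u^α) ∂xⁱ/∂y^j`. -/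
theorem jet_transition {y : X × (F × (X →L[ℝ] F))} (hy : (y.1, y.2.1) ∈ c.total.target)
    (hy' : c.total.symm (y.1, y.2.1) ∈ c'.total.source) :
    c'.jetCoord (c.jetOfCoord y) =
      ((c'.total (c.total.symm (y.1, y.2.1))).1, ((c'.total (c.total.symm (y.1, y.2.1))).2,
        (ContinuousLinearMap.snd ℝ X F).comp
          ((fderiv ℝ (c'.total ∘ c.total.symm) (y.1, y.2.1)).comp
            (((ContinuousLinearMap.id ℝ X).prod y.2.2).comp
              (fderiv ℝ (c.base ∘ c'.base.symm)
                (c'.total (c.total.symm (y.1, y.2.1))).1))))) := by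
  have h := c.total.map_target hy
  have h1 := chartDeriv_comp_inverse c.total_mem c'.total_mem h hy'
  have h2 := chartDeriv_comp_inverse c'.base_mem c.base_mem (c'.mapsTo _ hy') (c.mapsTo _ h)
  rw [c.total.right_inv hy] at h1
  rw [c'.fst_eq _ hy', ← h1, ← h2]
  rw [c.jetOfCoord_of_mem h]
  rfl

theorem jet_transition_source :
    (c.jetPartialEquiv.symm.trans c'.jetPartialEquiv).source =
      (fun y : X × (F × (X →L[ℝ] F)) => (y.1, y.2.1)) ⁻¹' (c.total.symm ≫ₕ c'.total).source := by
  ext y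
  change (y.1, y.2.1) ∈ c.total.target ∧ (c.jetOfCoord y).pt ∈ c'.total.source ↔ _
  rw [jetOfCoord_pt]
  simp

theorem isOpen_jet_transition :
    IsOpen (c.jetPartialEquiv.symm.trans c'.jetPartialEquiv).source := by
  rw [jet_transition_source]
  exact (c.total.symm ≫ₕ c'.total).open_source.preimage (by fun_prop)

theorem contDiffOn_jet_transition :
    ContDiffOn ℝ ∞ (c.jetPartialEquiv.symm.trans c'.jetPartialEquiv)
      (c.jetPartialEquiv.symm.trans c'.jetPartialEquiv).source := by
  have hmem : ∀ y ∈ (c.jetPartialEquiv.symm.trans c'.jetPartialEquiv).source,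
      (y.1, y.2.1) ∈ (c.total.symm ≫ₕ c'.total).source := by
    intro y hy
    rwa [jet_transition_source] at hy
  have hpr : ContDiff ℝ ∞ (fun y : X × (F × (X →L[ℝ] F)) => (y.1, y.2.1)) := by fun_prop
  have hτ := contDiffOn_transition c.total_mem c'.total_mem
  have hτ' : ContDiffOn ℝ ∞ (fderiv ℝ (c'.total ∘ c.total.symm))
      (c.total.symm ≫ₕ c'.total).source :=
    hτ.fderiv_of_isOpen (c.total.symm ≫ₕ c'.total).open_source (by simp)
  have hβ := contDiffOn_transition c'.base_mem c.base_mem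
  have hβ' : ContDiffOn ℝ ∞ (fderiv ℝ (c.base ∘ c'.base.symm))
      (c'.base.symm ≫ₕ c.base).source :=
    hβ.fderiv_of_isOpen (c'.base.symm ≫ₕ c.base).open_source (by simp)
  have h1 := hτ.comp hpr.contDiffOn hmem
  have h2 := hτ'.comp hpr.contDiffOn hmem
  have h3 : ContDiffOn ℝ ∞ (fun y : X × (F × (X →L[ℝ] F)) =>
      fderiv ℝ (c.base ∘ c'.base.symm) (c'.total (c.total.symm (y.1, y.2.1))).1)
      (c.jetPartialEquiv.symm.trans c'.jetPartialEquiv).source := by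
    refine hβ'.comp h1.fst ?_
    intro y hy
    have h := hmem y hy
    simp only [OpenPartialHomeomorph.trans_source, OpenPartialHomeomorph.symm_source,
      mem_inter_iff, mem_preimage] at h
    have h' := c.total.map_target h.1
    simp only [OpenPartialHomeomorph.trans_source, OpenPartialHomeomorph.symm_source,
      mem_inter_iff, mem_preimage]
    rw [c'.fst_eq _ h.2]
    refine ⟨c'.base.map_source (c'.mapsTo _ h.2), ?_⟩
    rw [c'.base.left_inv (c'.mapsTo _ h.2)]
    exact c.mapsTo _ h'
  have h4 : ContDiff ℝ ∞ (fun y : X × (F × (X →L[ℝ] F)) =>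
      (ContinuousLinearMap.id ℝ X).prod y.2.2) := by
    have : (fun y : X × (F × (X →L[ℝ] F)) => (ContinuousLinearMap.id ℝ X).prod y.2.2) =
        fun y => (ContinuousLinearMap.inl ℝ X F) +
          (ContinuousLinearMap.inr ℝ X F).comp y.2.2 := by
      funext y; ext v <;> simp
    rw [this]
    exact contDiff_const.add (contDiff_const.clm_comp (by fun_prop))
  have h5 := h1.fst.prodMk (h1.snd.prodMk
    ((contDiffOn_const (c := ContinuousLinearMap.snd ℝ X F)).clm_comp
      (h2.clm_comp (h4.contDiffOn.clm_comp h3))))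
  refine h5.congr fun y hy => ?_
  have h := hmem y hy
  simp only [OpenPartialHomeomorph.trans_source, OpenPartialHomeomorph.symm_source,
    mem_inter_iff, mem_preimage] at h
  exact c.jet_transition c' h.1 h.2

end FiberedChart

namespace Jet1

/-- The atlas of `J¹π` given by the coordinates induced by all adapted coordinates. -/
def chartedSpaceCore (π : E → M) [IsFibration X F π] :
    ChartedSpaceCore (X × (F × (X →L[ℝ] F))) (Jet1 X F π) where
  atlas := range fun c : FiberedChart X F π => c.jetPartialEquiv
  chartAt z := (IsFibration.exists_fiberedChart (X := X) (F := F) (π := π) z.pt).choose.jetPartialEquiv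
  mem_chart_source z :=
    (IsFibration.exists_fiberedChart (X := X) (F := F) (π := π) z.pt).choose_spec
  chart_mem_atlas z := mem_range_self _
  open_source := by
    rintro _ _ ⟨c, rfl⟩ ⟨c', rfl⟩
    exact c.isOpen_jet_transition c'
  continuousOn_toFun := by
    rintro _ _ ⟨c, rfl⟩ ⟨c', rfl⟩
    exact (c.contDiffOn_jet_transition c').continuousOn

variable [IsFibration X F π]

instance instTopologicalSpace : TopologicalSpace (Jet1 X F π) :=
  (chartedSpaceCore π).toTopologicalSpace

instance instChartedSpace : ChartedSpace (X × (F × (X →L[ℝ] F))) (Jet1 X F π) :=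
  (chartedSpaceCore π).toChartedSpace

theorem mem_atlas_iff {e : OpenPartialHomeomorph (Jet1 X F π) (X × (F × (X →L[ℝ] F)))} :
    e ∈ atlas (X × (F × (X →L[ℝ] F))) (Jet1 X F π) ↔
      ∃ c : FiberedChart X F π, e = (chartedSpaceCore π).openPartialHomeomorph
        c.jetPartialEquiv (mem_range_self c) := by
  change e ∈ ⋃ (e : PartialEquiv _ _) (he : e ∈ (chartedSpaceCore π).atlas),
    {(chartedSpaceCore π).openPartialHomeomorph e he} ↔ _
  simp only [mem_iUnion, mem_singleton_iff]
  constructor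
  · rintro ⟨_, ⟨c, rfl⟩, rfl⟩
    exact ⟨c, rfl⟩
  · rintro ⟨c, rfl⟩
    exact ⟨_, mem_range_self c, rfl⟩

instance instIsManifold : IsManifold 𝓘(ℝ, X × (F × (X →L[ℝ] F))) ∞ (Jet1 X F π) := by
  refine isManifold_of_contDiffOn _ _ _ fun e e' he he' => ?_
  obtain ⟨c, rfl⟩ := mem_atlas_iff.1 he
  obtain ⟨c', rfl⟩ := mem_atlas_iff.1 he'
  simpa using! c.contDiffOn_jet_transition c'

/-- The projection `π₁ : J¹π → M`. -/
def proj (z : Jet1 X F π) : M := π z.pt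

end Jet1

/-- The adapted coordinates `(xⁱ, (u^α, u^α_i))` of `π₁ : J¹π → M` induced by adapted coordinates
`(xⁱ, u^α)` of `π`. -/
def FiberedChart.jet [IsFibration X F π] (c : FiberedChart X F π) :
    FiberedChart X (F × (X →L[ℝ] F)) (Jet1.proj (X := X) (F := F) (π := π)) where
  base := c.base
  total := (Jet1.chartedSpaceCore π).openPartialHomeomorph c.jetPartialEquiv (mem_range_self c)
  base_mem := c.base_mem
  total_mem := IsManifold.subset_maximalAtlas (Jet1.mem_atlas_iff.2 ⟨c, rfl⟩)
  mapsTo z hz := c.mapsTo z.pt hz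
  fst_eq _ _ := rfl

instance Jet1.instIsFibration [IsFibration X F π] :
    IsFibration X (F × (X →L[ℝ] F)) (Jet1.proj (X := X) (F := F) (π := π)) where
  surjective x := by
    obtain ⟨p, rfl⟩ := IsFibration.surjective (X := X) (F := F) (π := π) x
    exact ⟨⟨p, (nonempty_jetFiber p).some⟩, rfl⟩
  isSubmersion z := by
    obtain ⟨c, hc⟩ := IsFibration.exists_fiberedChart (X := X) (F := F) (π := π) z.pt
    refine Manifold.IsSubmersionAtOfComplement.mk_of_charts (ContinuousLinearEquiv.refl ℝ _)
      c.jet.total c.jet.base hc (c.jet.mapsTo z hc) c.jet.total_mem c.jet.base_mem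
      (fun y hy => c.jet.mapsTo y hy) ?_
    intro y hy
    have hy' : y ∈ c.jet.total.target := by simpa using hy
    have h := c.jet.fst_eq _ (c.jet.total.map_target hy')
    rw [c.jet.total.right_inv hy'] at h
    simpa using h.symm

section Prolongation

variable [IsFibration X F π]

theorem Jet1.contMDiff_pt :
    ContMDiff 𝓘(ℝ, X × (F × (X →L[ℝ] F))) 𝓘(ℝ, X × F) ∞ (Jet1.pt : Jet1 X F π → E) := by
  intro z
  obtain ⟨c, hc⟩ := IsFibration.exists_fiberedChart (X := X) (F := F) (π := π) z.pt
  have hz : z ∈ c.jet.total.source := hc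
  have h1 : ContMDiffOn 𝓘(ℝ, X × (F × (X →L[ℝ] F))) 𝓘(ℝ, X × F) ∞
      (fun w : Jet1 X F π => ((c.jet.total w).1, (c.jet.total w).2.1)) c.jet.total.source := by
    have : ContDiff ℝ ∞ (fun y : X × (F × (X →L[ℝ] F)) => (y.1, y.2.1)) := by fun_prop
    exact this.contMDiff.comp_contMDiffOn (contMDiffOn_of_mem_maximalAtlas c.jet.total_mem)
  have h0 : ∀ w ∈ c.jet.total.source,
      ((c.jet.total w).1, (c.jet.total w).2.1) = c.total w.pt := by
    intro w hw
    exact Prod.ext (c.fst_eq _ hw).symm rfl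
  have h2 := (contMDiffOn_symm_of_mem_maximalAtlas c.total_mem).comp h1 (by
    intro w hw
    simp only [mem_preimage]
    rw [h0 w hw]
    exact c.total.map_source hw)
  refine (h2.congr fun w hw => ?_).contMDiffAt (c.jet.total.open_source.mem_nhds hz)
  simp only [Function.comp_apply]
  rw [h0 w hw, c.total.left_inv hw]

variable (X F π) in
/-- The iterated jet bundle `J¹π₁`. -/
abbrev IteratedJet : Type _ :=
  Jet1 X (F × (X →L[ℝ] F)) (Jet1.proj (X := X) (F := F) (π := π))

/-- The prolongation `j¹(π_{1,0}) : J¹π₁ → J¹π`, `j¹_x σ ↦ j¹_x (π_{1,0} ∘ σ)`, that is,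
`T_x σ ↦ T π_{1,0} ∘ T_x σ`. -/
def IteratedJet.prolong (w : IteratedJet X F π) : Jet1 X F π where
  pt := w.pt.pt
  jet :=
    { lin := (mfderiv 𝓘(ℝ, X × (F × (X →L[ℝ] F))) 𝓘(ℝ, X × F) Jet1.pt w.pt).comp w.jet.lin
      isSection := by
        have h := mfderiv_comp w.pt (IsFibration.mdifferentiableAt (X := X) (F := F) (π := π) w.pt.pt)
          ((Jet1.contMDiff_pt (X := X) (F := F) w.pt).mdifferentiableAt (by simp))
        ext v
        exact (congrArg (fun L => L (w.jet.lin v)) h.symm).trans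
          (congrArg (fun L => L v) w.jet.isSection) }

variable (X F π) in
/-- A smooth local section of `π`, defined on an open subset of `M`; the values outside of the
domain are irrelevant. -/
structure LocalSection where
  dom : Set M
  toFun : M → E
  isOpen_dom : IsOpen dom
  contMDiffOn : ContMDiffOn 𝓘(ℝ, X) 𝓘(ℝ, X × F) ∞ toFun dom
  proj_eq : ∀ x ∈ dom, π (toFun x) = x

/-- The jet `j¹_x s`, that is, the tangent map `T_x s : T_x M → T_{s x} E`, where `π (s x) = x`. -/
def LocalSection.jet (s : LocalSection X F π) (x : M) (hx : x ∈ s.dom) : Jet1 X F π where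
  pt := s.toFun x
  jet :=
    { lin := (s.proj_eq x hx).symm ▸ mfderiv 𝓘(ℝ, X) 𝓘(ℝ, X × F) s.toFun x
      isSection := by
        have hs : MDifferentiableAt 𝓘(ℝ, X) 𝓘(ℝ, X × F) s.toFun x :=
          (s.contMDiffOn.contMDiffAt (s.isOpen_dom.mem_nhds hx)).mdifferentiableAt (by simp)
        have h := mfderiv_comp x
          (IsFibration.mdifferentiableAt (X := X) (F := F) (π := π) (s.toFun x)) hs
        have h2 : π ∘ s.toFun =ᶠ[𝓝 x] id := by
          filter_upwards [s.isOpen_dom.mem_nhds hx] with y hy using s.proj_eq y hy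
        rw [h2.mfderiv_eq, mfderiv_id] at h
        have key : ∀ (y : M) (e : x = y) (p : E)
            (L : TangentSpace 𝓘(ℝ, X) x →L[ℝ] TangentSpace 𝓘(ℝ, X × F) p)
            (v : TangentSpace 𝓘(ℝ, X) y),
            (e ▸ L : TangentSpace 𝓘(ℝ, X) y →L[ℝ] TangentSpace 𝓘(ℝ, X × F) p) v = L v := by
          rintro y rfl p L v; rfl
        ext v
        rw [ContinuousLinearMap.comp_apply, key]
        exact (congrArg (fun L => L v) h).symm }

/-- `z = (1 - t) z₀ + t z₁` in one of the fibres of the affine bundle `π_{1,0} : J¹π → E`. -/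
def Jet1.IsAffineComb (t : ℝ) (z₀ z₁ z : Jet1 X F π) : Prop :=
  ∃ (p : E) (a b : JetFiber X F π p), z₀ = ⟨p, a⟩ ∧ z₁ = ⟨p, b⟩ ∧ z = ⟨p, a.lineMap b t⟩

/-- `w = (1 - t) w₀ + t w₁` in one of the fibres of the affine bundle `j¹(π_{1,0}) : J¹π₁ → J¹π`,
the prolongation of the affine bundle `π_{1,0} : J¹π → E`: that is, `w₀ = j¹_x σ₀`, `w₁ = j¹_x σ₁`
and `w = j¹_x ((1 - t) σ₀ + t σ₁)` for local sections `σ₀`, `σ₁` of `π₁` that lie over the same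
local section of `π`. -/
def IteratedJet.IsProlongedAffineComb (t : ℝ) (w₀ w₁ w : IteratedJet X F π) : Prop :=
  ∃ (σ₀ σ₁ σ : LocalSection X (F × (X →L[ℝ] F)) (Jet1.proj (X := X) (F := F) (π := π)))
    (x : M) (h₀ : x ∈ σ₀.dom) (h₁ : x ∈ σ₁.dom) (h : x ∈ σ.dom),
    (∀ᶠ y in 𝓝 x, Jet1.IsAffineComb t (σ₀.toFun y) (σ₁.toFun y) (σ.toFun y)) ∧
      w₀ = σ₀.jet x h₀ ∧ w₁ = σ₁.jet x h₁ ∧ w = σ.jet x h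

end Prolongation

end General

section Coordinates

variable {m n : ℕ} {M : Type uM} {E : Type uE}
  [TopologicalSpace M] [ChartedSpace (EuclideanSpace ℝ (Fin m)) M]
  [IsManifold 𝓘(ℝ, EuclideanSpace ℝ (Fin m)) ∞ M]
  [TopologicalSpace E] [ChartedSpace (EuclideanSpace ℝ (Fin m) × EuclideanSpace ℝ (Fin n)) E]
  {π : E → M}

variable (m M) in
/-- Linear connections on the `m`-dimensional manifold `M`: covariant derivatives on `TM`. Here
`cov Y x (X x)` is `(∇_X Y)(x)`. -/
abbrev LinearConnection : Type _ :=
  CovariantDerivative 𝓘(ℝ, EuclideanSpace ℝ (Fin m)) (EuclideanSpace ℝ (Fin m))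
    (TangentSpace 𝓘(ℝ, EuclideanSpace ℝ (Fin m)) : M → Type _)

/-- The coordinate vector field `∂/∂xʲ` of a chart `(xⁱ)` of `M` (on the domain of the chart; the
values elsewhere are irrelevant). -/
def coordField (φ : OpenPartialHomeomorph M (EuclideanSpace ℝ (Fin m))) (j : Fin m) (x : M) :
    TangentSpace 𝓘(ℝ, EuclideanSpace ℝ (Fin m)) x :=
  (chartDeriv φ x).inverse (EuclideanSpace.single j 1)

/-- The Christoffel symbols `Γᵏ_{ij}` of a linear connection with respect to a chart `(xⁱ)` of `M`,
`∇_{∂/∂xⁱ} ∂/∂xʲ = Γᵏ_{ij} ∂/∂xᵏ`. -/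
def christoffel (cov : LinearConnection m M)
    (φ : OpenPartialHomeomorph M (EuclideanSpace ℝ (Fin m))) (x : M) (k i j : Fin m) : ℝ :=
  chartDeriv φ x (cov (coordField φ j) x (coordField φ i x)) k

variable [IsManifold 𝓘(ℝ, EuclideanSpace ℝ (Fin m) × EuclideanSpace ℝ (Fin n)) ∞ E]
  [IsFibration (EuclideanSpace ℝ (Fin m)) (EuclideanSpace ℝ (Fin n)) π]

namespace FiberedChart

variable (c : FiberedChart (EuclideanSpace ℝ (Fin m)) (EuclideanSpace ℝ (Fin n)) π)
  (w : IteratedJet (EuclideanSpace ℝ (Fin m)) (EuclideanSpace ℝ (Fin n)) π)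

/-- The natural coordinate `xⁱ` on `J¹π₁`. -/
def x (i : Fin m) : ℝ := (c.jet.jetCoord w).1 i

/-- The natural coordinate `u^α` on `J¹π₁`. -/
def u (α : Fin n) : ℝ := (c.jet.jetCoord w).2.1.1 α

/-- The natural coordinate `u^α_i` on `J¹π₁`. -/
def u₁ (α : Fin n) (i : Fin m) : ℝ :=
  (c.jet.jetCoord w).2.1.2 (EuclideanSpace.single i 1) α

/-- The natural coordinate `ū^α_j` on `J¹π₁`: at `j¹_x σ` it is `∂(u^α ∘ σ)/∂xʲ`. -/
def ubar (α : Fin n) (j : Fin m) : ℝ :=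
  ((c.jet.jetCoord w).2.2 (EuclideanSpace.single j 1)).1 α

/-- The natural coordinate `u^α_{ij}` on `J¹π₁`: at `j¹_x σ` it is `∂(u^α_i ∘ σ)/∂xʲ`. -/
def u₂ (α : Fin n) (i j : Fin m) : ℝ :=
  ((c.jet.jetCoord w).2.2 (EuclideanSpace.single j 1)).2 (EuclideanSpace.single i 1) α

end FiberedChart

/-- `ex` has, in all systems of natural coordinates `(xⁱ, u^α, u^α_i, ū^α_j, u^α_{ij})` of `J¹π₁`
(which are induced by adapted coordinates of `π`), the expression
`(xⁱ, u^α, u^α_i, ū^α_j, u^α_{ij}) ↦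
  (xⁱ, u^α, ū^α_i, u^α_j, u^α_{ji} + (ū^α_k - u^α_k) Γᵏ_{ji})`. -/
def IsExchangeMap (cov : LinearConnection m M)
    (ex : IteratedJet (EuclideanSpace ℝ (Fin m)) (EuclideanSpace ℝ (Fin n)) π →
      IteratedJet (EuclideanSpace ℝ (Fin m)) (EuclideanSpace ℝ (Fin n)) π) : Prop :=
  ∀ (c : FiberedChart (EuclideanSpace ℝ (Fin m)) (EuclideanSpace ℝ (Fin n)) π)
    (w : IteratedJet (EuclideanSpace ℝ (Fin m)) (EuclideanSpace ℝ (Fin n)) π),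
    w.pt.pt ∈ c.total.source →
      (ex w).pt.pt ∈ c.total.source ∧
      (∀ i, c.x (ex w) i = c.x w i) ∧
      (∀ α, c.u (ex w) α = c.u w α) ∧
      (∀ α i, c.u₁ (ex w) α i = c.ubar w α i) ∧
      (∀ α j, c.ubar (ex w) α j = c.u₁ w α j) ∧
      (∀ α i j, c.u₂ (ex w) α i j = c.u₂ w α j i +
        ∑ k, (c.ubar w α k - c.u₁ w α k) * christoffel cov c.base (π w.pt.pt) k j i)

/-- The linear connection `∇ + T`, where `T` is the torsion tensor of `∇`; that is,
`(∇ + T)_X Y = ∇_X Y + T(Y, X)`. -/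
def addTorsion (cov : LinearConnection m M) :
    CovariantDerivative 𝓘(ℝ, EuclideanSpace ℝ (Fin m)) (EuclideanSpace ℝ (Fin m))
      (TangentSpace 𝓘(ℝ, EuclideanSpace ℝ (Fin m)) : M → Type _) :=
  cov.addOneForm cov.torsion

variable (m n) in
/-- The model vector space of the manifold `J¹π₁`. -/
abbrev IteratedJetModel : Type :=
  EuclideanSpace ℝ (Fin m) ×
    ((EuclideanSpace ℝ (Fin n) ×
        (EuclideanSpace ℝ (Fin m) →L[ℝ] EuclideanSpace ℝ (Fin n))) ×
      (EuclideanSpace ℝ (Fin m) →L[ℝ]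
        (EuclideanSpace ℝ (Fin n) ×
          (EuclideanSpace ℝ (Fin m) →L[ℝ] EuclideanSpace ℝ (Fin n)))))

end Coordinates

end JetExchange

end

open JetExchange

noncomputable section

/-! Without indices, an iterated jet has coordinates `(x, ((u, A), B))`, where `A` collects the
u^α_i and `B = (β, C)` the ū^α_j and the u^α_ij. With the Christoffel symbols read as a bilinear map
`Γ`, the required expression is `exchangeCoord Γ`: swap `A` and `β`, transpose `C`, add `(β - A) ∘
Γ`.

The main point is that this expression does not depend on the coordinates
(`IsJetChange.exchangeCoord`). A change of coordinates adds to `C` a term with the second derivative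
of the change on `E`, which is symmetric and so survives the transposition, and a term in which the
second derivative `b₂` of the change on `M` is paired with `A`. After the swap, `b₂` has to be
paired with `β` instead, so transposition alone misses `(β - A) ∘ b₂`. This is what the
inhomogeneous term of the transformation law of `Γ` supplies (`christoffelMap_transition`). Hence an
image point defined in one chart has the right coordinates in all charts, and it is unique because
coordinates separate points.

The other claims are read off in coordinates. The map for `Γ.flip` inverts the one for `Γ`
(`exchangeCoord_flip_exchangeCoord`), and the symbols of ∇ + T are the flipped ones
(`christoffelMap_addTorsion`). The square of the map adds to `C` the composite of `A - β` with the
antisymmetric part of `Γ`, that is, with the torsion; since `A - β` is arbitrary, this vanishes only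
if T = 0. Finally, (π₁)_{1,0} is `(x, u, A)` with affine fibre coordinates `(β, C)`, and j¹(π_{1,0})
is `(x, u, β)` with affine fibre coordinates `(A, C)`. As `(β - A) ∘ Γ` is affine in `β` and in `A`,
the two structures are exchanged. -/

namespace JetExchange

set_option linter.unusedSectionVars false

/-! ### Christoffel symbols as a bilinear map: transformation law, torsion, smoothness. -/

section Christoffel

variable {m : ℕ} {M : Type*} [TopologicalSpace M] [ChartedSpace (EuclideanSpace ℝ (Fin m)) M]
  [IsManifold 𝓘(ℝ, EuclideanSpace ℝ (Fin m)) ∞ M]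

/-- A vector field as a section of the tangent bundle. -/
abbrev fieldSection (Y : ∀ x : M, TangentSpace 𝓘(ℝ, EuclideanSpace ℝ (Fin m)) x) (x : M) :
    TangentBundle 𝓘(ℝ, EuclideanSpace ℝ (Fin m)) M :=
  Bundle.TotalSpace.mk' (EuclideanSpace ℝ (Fin m)) x (Y x)

/-- Differentiability of a vector field at a point. -/
abbrev MDiffFieldAt (Y : ∀ x : M, TangentSpace 𝓘(ℝ, EuclideanSpace ℝ (Fin m)) x) (x : M) : Prop :=
  MDifferentiableAt 𝓘(ℝ, EuclideanSpace ℝ (Fin m)) 𝓘(ℝ, EuclideanSpace ℝ (Fin m)).tangent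
    (fieldSection Y) x

/-- Smoothness of a vector field at a point. -/
abbrev SmoothFieldAt (Y : ∀ x : M, TangentSpace 𝓘(ℝ, EuclideanSpace ℝ (Fin m)) x) (x : M) :
    Prop :=
  ContMDiffAt 𝓘(ℝ, EuclideanSpace ℝ (Fin m)) 𝓘(ℝ, EuclideanSpace ℝ (Fin m)).tangent ∞
    (fieldSection Y) x

/-- The Christoffel symbols in a chart `φ` as a bilinear map; for constant `w` this is the
expression of `∇_v w` in the chart. -/
def christoffelMap (cov : LinearConnection m M)
    (φ : OpenPartialHomeomorph M (EuclideanSpace ℝ (Fin m))) (x : M) :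
    EuclideanSpace ℝ (Fin m) →L[ℝ] EuclideanSpace ℝ (Fin m) →L[ℝ] EuclideanSpace ℝ (Fin m) :=
  (∑ j, (EuclideanSpace.proj (𝕜 := ℝ) j).smulRight
    ((chartDeriv φ x).comp ((cov (coordField φ j) x).comp (chartDeriv φ x).inverse) :
      EuclideanSpace ℝ (Fin m) →L[ℝ] EuclideanSpace ℝ (Fin m))).flip

theorem christoffelMap_apply (cov : LinearConnection m M)
    (φ : OpenPartialHomeomorph M (EuclideanSpace ℝ (Fin m))) (x : M)
    (v w : EuclideanSpace ℝ (Fin m)) :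
    christoffelMap cov φ x v w =
      ∑ j, w j • chartDeriv φ x (cov (coordField φ j) x ((chartDeriv φ x).inverse v)) := by
  simp [christoffelMap, sum_apply]

theorem christoffelMap_single (cov : LinearConnection m M)
    (φ : OpenPartialHomeomorph M (EuclideanSpace ℝ (Fin m))) (x : M) (i j : Fin m) :
    christoffelMap cov φ x (EuclideanSpace.single i 1) (EuclideanSpace.single j 1) =
      chartDeriv φ x (cov (coordField φ j) x (coordField φ i x)) := by
  rw [christoffelMap_apply, Finset.sum_eq_single j]
  · simp [coordField]
  · intro b _ hb
    simp [hb]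
  · simp

theorem christoffelMap_single_apply (cov : LinearConnection m M)
    (φ : OpenPartialHomeomorph M (EuclideanSpace ℝ (Fin m))) (x : M) (k i j : Fin m) :
    christoffelMap cov φ x (EuclideanSpace.single i 1) (EuclideanSpace.single j 1) k =
      christoffel cov φ x k i j := by
  rw [christoffelMap_single, christoffel]

variable {φ φ' : OpenPartialHomeomorph M (EuclideanSpace ℝ (Fin m))} {x : M}

theorem smoothFieldAt_const (v y : EuclideanSpace ℝ (Fin m)) :
    SmoothFieldAt (M := EuclideanSpace ℝ (Fin m)) (fun _ => v) y :=
  contMDiff_vectorSpace_iff_contDiff.2 contDiff_const y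

/-- A coordinate field is the pullback by the chart of a constant field. -/
theorem contMDiffAt_coordField
    (hφ : φ ∈ IsManifold.maximalAtlas 𝓘(ℝ, EuclideanSpace ℝ (Fin m)) ∞ M) (hx : x ∈ φ.source)
    (j : Fin m) :
    SmoothFieldAt (coordField φ j) x :=
  ContMDiffAt.mpullback_vectorField_preimage (I' := 𝓘(ℝ, EuclideanSpace ℝ (Fin m)))
    (n := ∞) (f := φ) (smoothFieldAt_const (EuclideanSpace.single j 1) _)
    ((contMDiffOn_of_mem_maximalAtlas hφ).contMDiffAt (φ.open_source.mem_nhds hx))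
    (isInvertible_chartDeriv hφ hx) (by simp)

theorem mdifferentiableAt_coordField
    (hφ : φ ∈ IsManifold.maximalAtlas 𝓘(ℝ, EuclideanSpace ℝ (Fin m)) ∞ M) (hx : x ∈ φ.source)
    (j : Fin m) :
    MDiffFieldAt ((coordField φ j)) x :=
  (contMDiffAt_coordField hφ hx j).mdifferentiableAt (by simp)

theorem mlieBracket_const {V : Type*} [NormedAddCommGroup V] [NormedSpace ℝ V] (v w y : V) :
    VectorField.mlieBracket 𝓘(ℝ, V) (fun _ => v) (fun _ => w) y = 0 :=
  (congrFun (VectorField.mlieBracketWithin_univ (I := 𝓘(ℝ, V)) (V := fun _ => v)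
    (W := fun _ => w)) y).symm.trans <|
    (congrFun (VectorField.mlieBracketWithin_eq_lieBracketWithin (𝕜 := ℝ) (V := fun _ => v)
      (W := fun _ => w) (s := univ)) y).trans <| by
      change fderivWithin ℝ (fun _ : V => w) univ y v - fderivWithin ℝ (fun _ : V => v) univ y w = 0
      simp

/-- The bracket commutes with pullback by the chart, and constant fields have bracket zero. -/
theorem mlieBracket_coordField
    (hφ : φ ∈ IsManifold.maximalAtlas 𝓘(ℝ, EuclideanSpace ℝ (Fin m)) ∞ M) (hx : x ∈ φ.source)
    (i j : Fin m) :
    VectorField.mlieBracket 𝓘(ℝ, EuclideanSpace ℝ (Fin m)) (coordField φ i) (coordField φ j) x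
      = 0 := by
  have hc : ∀ v y : EuclideanSpace ℝ (Fin m),
      MDiffFieldAt (M := EuclideanSpace ℝ (Fin m)) (fun _ => v) y :=
    fun v y => (smoothFieldAt_const v y).mdifferentiableAt (by simp)
  have : IsManifold 𝓘(ℝ, EuclideanSpace ℝ (Fin m)) (minSmoothness ℝ 2) M := by
    simpa using IsManifold.of_le (n := ∞) (WithTop.coe_le_coe.2 (le_top : (2 : ℕ∞) ≤ ⊤))
  have h := VectorField.mpullback_mlieBracket (x₀ := x) (f := φ) (n := ∞)
    (hc (EuclideanSpace.single i 1) (φ x)) (hc (EuclideanSpace.single j 1) (φ x))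
    ((contMDiffOn_of_mem_maximalAtlas hφ).contMDiffAt (φ.open_source.mem_nhds hx))
    (by simpa using (WithTop.coe_le_coe.2 (le_top : (2 : ℕ∞) ≤ ⊤) : (2 : ℕ∞ω) ≤ ∞))
  refine h.symm.trans ?_
  rw [VectorField.mpullback_apply]
  exact (congrArg _ (mlieBracket_const _ _ _)).trans (map_zero _)

/-- The covariant derivative of a finite sum of vector fields. -/
theorem cov_sum_smul (cov : LinearConnection m M) {ι : Type*} (s : Finset ι)
    {Y : ι → ∀ x : M, TangentSpace 𝓘(ℝ, EuclideanSpace ℝ (Fin m)) x} {f : ι → M → ℝ}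
    (hY : ∀ i, MDiffFieldAt ((Y i)) x) (hf : ∀ i, MDifferentiableAt 𝓘(ℝ, EuclideanSpace ℝ (Fin m)) 𝓘(ℝ, ℝ) (f i) x)
    (v : TangentSpace 𝓘(ℝ, EuclideanSpace ℝ (Fin m)) x) :
    cov (fun y => ∑ i ∈ s, f i y • Y i y) x v =
      ∑ i ∈ s, (f i x • cov (Y i) x v +
        (mvfderiv 𝓘(ℝ, EuclideanSpace ℝ (Fin m)) (f i) x v) • Y i x) := by
  classical
  induction s using Finset.induction_on with
  | empty =>
    simp only [Finset.sum_empty]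
    exact congrArg (fun L => L x v) cov.zero
  | insert i s hi ih =>
    have h1 : MDiffFieldAt ((fun y => f i y • Y i y)) x := (hf i).smul_section (hY i)
    have h2 : MDiffFieldAt ((fun y => ∑ i ∈ s, f i y • Y i y)) x :=
      .sum_section fun i _ => (hf i).smul_section (hY i)
    have h3 := cov.isCovariantDerivativeOnUniv.add h1 h2
    have h4 := cov.isCovariantDerivativeOnUniv.leibniz (hY i) (hf i)
    simp only [Finset.sum_insert hi]
    rw [← ih]
    refine (congrArg (fun L => L v) h3).trans ?_
    rw [add_apply]
    congr 1
    exact congrArg (fun L => L v) h4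

/-- The Leibniz rule applied to Y = g^k ∂_k. As `g` is assumed to represent `Y` only near `x`, the
locality of the connection is used as well. -/
theorem chartDeriv_cov (cov : LinearConnection m M)
    (hφ : φ ∈ IsManifold.maximalAtlas 𝓘(ℝ, EuclideanSpace ℝ (Fin m)) ∞ M) (hx : x ∈ φ.source)
    {Y : ∀ x : M, TangentSpace 𝓘(ℝ, EuclideanSpace ℝ (Fin m)) x}
    {g : M → EuclideanSpace ℝ (Fin m)} (hYd : MDiffFieldAt (Y) x)
    (hg : MDifferentiableAt 𝓘(ℝ, EuclideanSpace ℝ (Fin m)) 𝓘(ℝ, EuclideanSpace ℝ (Fin m)) g x)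
    (hY : ∀ᶠ y in 𝓝 x, Y y = (chartDeriv φ y).inverse (g y))
    (v : TangentSpace 𝓘(ℝ, EuclideanSpace ℝ (Fin m)) x) :
    chartDeriv φ x (cov Y x v) =
      christoffelMap cov φ x (chartDeriv φ x v) (g x) +
        mvfderiv 𝓘(ℝ, EuclideanSpace ℝ (Fin m)) g x v := by
  have hgk : ∀ k, HasMFDerivAt 𝓘(ℝ, EuclideanSpace ℝ (Fin m)) 𝓘(ℝ, ℝ) (fun y => g y k) x
      ((EuclideanSpace.proj (𝕜 := ℝ) k).comp
        (mvfderiv 𝓘(ℝ, EuclideanSpace ℝ (Fin m)) g x)) := fun k =>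
    (EuclideanSpace.proj (𝕜 := ℝ) k).hasMFDerivAt.comp x hg.hasMFDerivAt
  have hsum : ∀ᶠ y in 𝓝 x, Y y = ∑ k, g y k • coordField φ k y := by
    filter_upwards [hY] with y hy
    rw [hy]
    conv_lhs => rw [← (EuclideanSpace.basisFun (Fin m) ℝ).sum_repr (g y)]
    simp [coordField, map_sum]
  have h2 : MDiffFieldAt ((fun y => ∑ k, g y k • coordField φ k y)) x :=
    .sum_section fun k _ =>
      (hgk k).mdifferentiableAt.smul_section (mdifferentiableAt_coordField hφ hx k)
  have h3 : cov Y x = cov (fun y => ∑ k, g y k • coordField φ k y) x :=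
    cov.isCovariantDerivativeOnUniv.congr_of_eventuallyEq hYd h2 univ_mem hsum
  rw [h3, cov_sum_smul cov _ (fun k => mdifferentiableAt_coordField hφ hx k)
    (fun k => (hgk k).mdifferentiableAt), map_sum, christoffelMap_apply]
  have hinv := isInvertible_chartDeriv hφ hx
  have h5 : ∀ k, mvfderiv 𝓘(ℝ, EuclideanSpace ℝ (Fin m)) (fun y => g y k) x v =
      (mvfderiv 𝓘(ℝ, EuclideanSpace ℝ (Fin m)) g x v) k := fun k => by
    rw [mvfderiv, (hgk k).mfderiv]; rfl
  simp only [map_add, map_smul, Finset.sum_add_distrib, h5, coordField, hinv.inverse_apply_self,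
    hinv.self_apply_inverse]
  congr 1
  conv_rhs => rw [← (EuclideanSpace.basisFun (Fin m) ℝ).sum_repr
    (mvfderiv 𝓘(ℝ, EuclideanSpace ℝ (Fin m)) g x v)]
  simp

/-- The transformation law of the Christoffel symbols. -/
theorem christoffelMap_transition (cov : LinearConnection m M)
    (hφ : φ ∈ IsManifold.maximalAtlas 𝓘(ℝ, EuclideanSpace ℝ (Fin m)) ∞ M)
    (hφ' : φ' ∈ IsManifold.maximalAtlas 𝓘(ℝ, EuclideanSpace ℝ (Fin m)) ∞ M)
    (hx : x ∈ φ.source) (hx' : x ∈ φ'.source) (v w : EuclideanSpace ℝ (Fin m)) :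
    fderiv ℝ (φ ∘ φ'.symm) (φ' x) (christoffelMap cov φ' x v w) =
      christoffelMap cov φ x (fderiv ℝ (φ ∘ φ'.symm) (φ' x) v)
        (fderiv ℝ (φ ∘ φ'.symm) (φ' x) w) +
      fderiv ℝ (fderiv ℝ (φ ∘ φ'.symm)) (φ' x) v w := by
  have hinv := isInvertible_chartDeriv hφ hx
  have hinv' := isInvertible_chartDeriv hφ' hx'
  have hD := chartDeriv_comp_inverse hφ' hφ hx' hx
  have hβ : ContDiffOn ℝ ∞ (fderiv ℝ (φ ∘ φ'.symm)) (φ'.symm ≫ₕ φ).source :=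
    (contDiffOn_transition hφ' hφ).fderiv_of_isOpen (φ'.symm ≫ₕ φ).open_source (by simp)
  have hmem : φ' x ∈ (φ'.symm ≫ₕ φ).source := by
    simp [hx, φ'.left_inv hx', φ'.map_source hx']
  have hβx : HasFDerivAt (fderiv ℝ (φ ∘ φ'.symm)) (fderiv ℝ (fderiv ℝ (φ ∘ φ'.symm)) (φ' x))
      (φ' x) :=
    ((hβ.contDiffAt ((φ'.symm ≫ₕ φ).open_source.mem_nhds hmem)).differentiableAt
      (by simp)).hasFDerivAt
  -- By linearity in `w` it suffices to treat basis vectors. In the chart `φ` the j-th coordinate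
  -- field of `φ'` has the components `D(φ ∘ φ'⁻¹) e_j`; these are not constant, and their
  -- derivative in `chartDeriv_cov` is the inhomogeneous term.
  have key : ∀ j, fderiv ℝ (φ ∘ φ'.symm) (φ' x)
        (chartDeriv φ' x (cov (coordField φ' j) x ((chartDeriv φ' x).inverse v))) =
      christoffelMap cov φ x (fderiv ℝ (φ ∘ φ'.symm) (φ' x) v)
        (fderiv ℝ (φ ∘ φ'.symm) (φ' x) (EuclideanSpace.single j 1)) +
      fderiv ℝ (fderiv ℝ (φ ∘ φ'.symm)) (φ' x) v (EuclideanSpace.single j 1) := by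
    intro j
    have hg : HasMFDerivAt 𝓘(ℝ, EuclideanSpace ℝ (Fin m)) 𝓘(ℝ, EuclideanSpace ℝ (Fin m))
        (fun y => fderiv ℝ (φ ∘ φ'.symm) (φ' y) (EuclideanSpace.single j 1)) x
        (((fderiv ℝ (fderiv ℝ (φ ∘ φ'.symm)) (φ' x)).flip (EuclideanSpace.single j 1)).comp
          (chartDeriv φ' x)) := by
      have h1 : HasFDerivAt (fun z => fderiv ℝ (φ ∘ φ'.symm) z (EuclideanSpace.single j 1))
          ((fderiv ℝ (fderiv ℝ (φ ∘ φ'.symm)) (φ' x)).flip (EuclideanSpace.single j 1))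
          (φ' x) := by
        simpa using! hβx.clm_apply (hasFDerivAt_const (EuclideanSpace.single j 1) _)
      exact HasMFDerivAt.comp x h1.hasMFDerivAt
        ((mdifferentiable_of_mem_maximalAtlas hφ').mdifferentiableAt hx').hasMFDerivAt
    have hY : ∀ᶠ y in 𝓝 x, coordField φ' j y = (chartDeriv φ y).inverse
        (fderiv ℝ (φ ∘ φ'.symm) (φ' y) (EuclideanSpace.single j 1)) := by
      filter_upwards [φ.open_source.mem_nhds hx, φ'.open_source.mem_nhds hx'] with y hy hy'
      rw [← chartDeriv_comp_inverse hφ' hφ hy' hy, ContinuousLinearMap.comp_apply,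
        (isInvertible_chartDeriv hφ hy).inverse_apply_self]
      rfl
    have h := chartDeriv_cov cov hφ hx (mdifferentiableAt_coordField hφ' hx' j)
      hg.mdifferentiableAt hY ((chartDeriv φ' x).inverse v)
    have h2 : mvfderiv 𝓘(ℝ, EuclideanSpace ℝ (Fin m))
        (fun y => fderiv ℝ (φ ∘ φ'.symm) (φ' y) (EuclideanSpace.single j 1)) x
        ((chartDeriv φ' x).inverse v) =
        fderiv ℝ (fderiv ℝ (φ ∘ φ'.symm)) (φ' x) v (EuclideanSpace.single j 1) := by
      have h3 : mvfderiv 𝓘(ℝ, EuclideanSpace ℝ (Fin m))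
        (fun y => fderiv ℝ (φ ∘ φ'.symm) (φ' y) (EuclideanSpace.single j 1)) x
        ((chartDeriv φ' x).inverse v) =
        fderiv ℝ (fderiv ℝ (φ ∘ φ'.symm)) (φ' x)
          (chartDeriv φ' x ((chartDeriv φ' x).inverse v)) (EuclideanSpace.single j 1) := by
        rw [mvfderiv, hg.mfderiv]; rfl
      rw [h3, hinv'.self_apply_inverse]
    rw [h2] at h
    have hDv : fderiv ℝ (φ ∘ φ'.symm) (φ' x) v =
        chartDeriv φ x ((chartDeriv φ' x).inverse v) := by
      rw [← hD]; rfl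
    rw [hDv, ← h, ← hD, ContinuousLinearMap.comp_apply, hinv'.inverse_apply_self]
  conv_rhs => rw [← (EuclideanSpace.basisFun (Fin m) ℝ).sum_repr w]
  rw [christoffelMap_apply]
  simp only [map_sum, map_smul, key, smul_add, Finset.sum_add_distrib,
    EuclideanSpace.basisFun_repr, EuclideanSpace.basisFun_apply]

theorem christoffelMap_ext {Γ Γ' : EuclideanSpace ℝ (Fin m) →L[ℝ] EuclideanSpace ℝ (Fin m) →L[ℝ]
      EuclideanSpace ℝ (Fin m)}
    (h : ∀ i j, Γ (EuclideanSpace.single i 1) (EuclideanSpace.single j 1) =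
      Γ' (EuclideanSpace.single i 1) (EuclideanSpace.single j 1)) : Γ = Γ' := by
  ext1 v
  ext1 w
  rw [← (EuclideanSpace.basisFun (Fin m) ℝ).sum_repr v,
    ← (EuclideanSpace.basisFun (Fin m) ℝ).sum_repr w]
  simp [h, map_sum, sum_apply]

theorem torsion_coordField (cov : LinearConnection m M)
    (hφ : φ ∈ IsManifold.maximalAtlas 𝓘(ℝ, EuclideanSpace ℝ (Fin m)) ∞ M) (hx : x ∈ φ.source)
    (i j : Fin m) :
    cov.torsion x (coordField φ i x) (coordField φ j x) =
      cov (coordField φ j) x (coordField φ i x) - cov (coordField φ i) x (coordField φ j x) := by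
  rw [cov.torsion_apply (mdifferentiableAt_coordField hφ hx i)
    (mdifferentiableAt_coordField hφ hx j), mlieBracket_coordField hφ hx, sub_zero]

/-- Coordinate fields commute, so T(∂_j, ∂_i) = ∇_j ∂_i - ∇_i ∂_j, and adding this to ∇_i ∂_j leaves
∇_j ∂_i. -/
theorem christoffelMap_addTorsion (cov : LinearConnection m M)
    (hφ : φ ∈ IsManifold.maximalAtlas 𝓘(ℝ, EuclideanSpace ℝ (Fin m)) ∞ M) (hx : x ∈ φ.source) :
    christoffelMap (addTorsion cov) φ x = (christoffelMap cov φ x).flip := by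
  refine christoffelMap_ext fun i j => ?_
  rw [ContinuousLinearMap.flip_apply, christoffelMap_single, christoffelMap_single]
  congr 1
  change cov (coordField φ j) x (coordField φ i x) +
    cov.torsion x (coordField φ j x) (coordField φ i x) = _
  rw [torsion_coordField cov hφ hx]
  abel

/-- Torsion is a tensor, so it is determined at `x` by its values on the coordinate fields, which
are the antisymmetrized symbols. -/
theorem torsion_eq_zero_iff_christoffelMap (cov : LinearConnection m M)
    (hφ : φ ∈ IsManifold.maximalAtlas 𝓘(ℝ, EuclideanSpace ℝ (Fin m)) ∞ M) (hx : x ∈ φ.source) :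
    cov.torsion x = 0 ↔ (christoffelMap cov φ x).flip = christoffelMap cov φ x := by
  have hinv := isInvertible_chartDeriv hφ hx
  constructor
  · intro h
    refine christoffelMap_ext fun i j => ?_
    rw [ContinuousLinearMap.flip_apply, christoffelMap_single, christoffelMap_single]
    have h1 := torsion_coordField cov hφ hx j i
    rw [h] at h1
    exact congrArg _ (sub_eq_zero.1 h1.symm)
  · intro h
    have h1 : ∀ i j, cov.torsion x (coordField φ i x) (coordField φ j x) = 0 := by
      intro i j
      rw [torsion_coordField cov hφ hx, sub_eq_zero]
      apply hinv.injective
      rw [← christoffelMap_single, ← christoffelMap_single]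
      exact (congrArg (fun L => L (EuclideanSpace.single i 1) (EuclideanSpace.single j 1)) h).symm
    have h2 : ∀ v : TangentSpace 𝓘(ℝ, EuclideanSpace ℝ (Fin m)) x,
        v = ∑ i, (chartDeriv φ x v) i • coordField φ i x := by
      intro v
      apply hinv.injective
      rw [map_sum]
      conv_lhs => rw [← (EuclideanSpace.basisFun (Fin m) ℝ).sum_repr (chartDeriv φ x v)]
      simp [coordField, hinv.self_apply_inverse]
    ext1 v
    ext1 w
    rw [h2 v, h2 w]
    simp [map_sum, sum_apply, h1]

/-- The function is the vector part of the tangent map of `φ` composed with `Y`. -/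
theorem contMDiffAt_chartDeriv_field
    (hφ : φ ∈ IsManifold.maximalAtlas 𝓘(ℝ, EuclideanSpace ℝ (Fin m)) ∞ M) (hx : x ∈ φ.source)
    {Y : ∀ x : M, TangentSpace 𝓘(ℝ, EuclideanSpace ℝ (Fin m)) x} (hY : SmoothFieldAt Y x) :
    ContMDiffAt 𝓘(ℝ, EuclideanSpace ℝ (Fin m)) 𝓘(ℝ, EuclideanSpace ℝ (Fin m)) ∞
      (fun y => chartDeriv φ y (Y y)) x := by
  have h1 := (contMDiffOn_of_mem_maximalAtlas hφ).contMDiffOn_tangentMapWithin (m := ∞) (by simp)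
    φ.open_source.uniqueMDiffOn
  have hmem : Bundle.TotalSpace.proj ⁻¹' φ.source ∈ 𝓝 (fieldSection Y x) :=
    (φ.open_source.preimage (FiberBundle.continuous_proj _ _)).mem_nhds hx
  have h2 := (h1.contMDiffAt hmem).comp x hY
  have h3 := (contMDiff_snd_tangentBundle_modelSpace (n := ∞) (EuclideanSpace ℝ (Fin m))
    𝓘(ℝ, EuclideanSpace ℝ (Fin m))).contMDiffAt.comp x h2
  refine h3.congr_of_eventuallyEq ?_
  filter_upwards [φ.open_source.mem_nhds hx] with y hy
  exact congrArg (fun L => L (Y y))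
    (mfderivWithin_of_mem_nhds (I := 𝓘(ℝ, EuclideanSpace ℝ (Fin m)))
      (I' := 𝓘(ℝ, EuclideanSpace ℝ (Fin m))) (f := φ) (φ.open_source.mem_nhds hy)).symm

/-- Smoothness of the connection is tested on globally smooth fields, whereas coordinate fields are
smooth only on the chart domain. A bump function supported there, equal to one near `x`, cuts the
field off; this is where the Hausdorff property enters. -/
theorem smoothFieldAt_cov_coordField [T2Space M] (cov : LinearConnection m M)
    [cov.ContMDiffCovariantDerivative ∞]
    (hφ : φ ∈ IsManifold.maximalAtlas 𝓘(ℝ, EuclideanSpace ℝ (Fin m)) ∞ M) (hx : x ∈ φ.source)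
    (i j : Fin m) :
    SmoothFieldAt (fun y => cov (coordField φ j) y (coordField φ i y)) x := by
  obtain ⟨f, -, hf⟩ := (SmoothBumpFunction.nhds_basis_tsupport
    (I := 𝓘(ℝ, EuclideanSpace ℝ (Fin m))) x).mem_iff.1 (φ.open_source.mem_nhds hx)
  have h1 : ContMDiff 𝓘(ℝ, EuclideanSpace ℝ (Fin m)) 𝓘(ℝ, EuclideanSpace ℝ (Fin m)).tangent ∞
      (fieldSection ((f : M → ℝ) • coordField φ j)) :=
    ContMDiffOn.smul_section_of_tsupport f.contMDiff.contMDiffOn φ.open_source hf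
      (fun y hy => (contMDiffAt_coordField hφ hy j).contMDiffWithinAt)
  have h2 := (CovariantDerivative.ContMDiffCovariantDerivative.contMDiff
    (cov := cov) (k := ∞)).contMDiff (σ := (f : M → ℝ) • coordField φ j) (by
      simpa using! h1.contMDiffOn)
  have h3 := (h2 x (mem_univ x)).contMDiffAt univ_mem
  have h4 := h3.clm_bundle_apply (contMDiffAt_coordField hφ hx i)
  refine h4.congr_of_eventuallyEq ?_
  -- The covariant derivative at `y` depends on the field near `y`, so the bump function must be one
  -- on a neighbourhood of each nearby `y`.
  filter_upwards [f.eventuallyEq_one.eventually_nhds, φ.open_source.mem_nhds hx] with y hy hyφ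
  have h5 : cov ((f : M → ℝ) • coordField φ j) y = cov (coordField φ j) y := by
    refine cov.isCovariantDerivativeOnUniv.congr_of_eventuallyEq
      ((h1 y).mdifferentiableAt (by simp)) (mdifferentiableAt_coordField hφ hyφ j) univ_mem ?_
    filter_upwards [hy] with z hz
    simp [hz]
  exact congrArg (fun L => (⟨y, L (coordField φ i y)⟩ :
    TangentBundle 𝓘(ℝ, EuclideanSpace ℝ (Fin m)) M)) h5.symm

/-- This form shows `Γ` as a sum of fixed continuous linear images of the vectors ∇_i ∂_j, from
which it inherits smoothness. -/
theorem christoffelMap_eq_sum (cov : LinearConnection m M)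
    (φ : OpenPartialHomeomorph M (EuclideanSpace ℝ (Fin m))) (x : M) :
    christoffelMap cov φ x = ∑ i, ∑ j, ContinuousLinearMap.smulRightL ℝ _ _
      (EuclideanSpace.proj (𝕜 := ℝ) i) (ContinuousLinearMap.smulRightL ℝ _ _
        (EuclideanSpace.proj (𝕜 := ℝ) j)
        (chartDeriv φ x (cov (coordField φ j) x (coordField φ i x)))) := by
  refine christoffelMap_ext fun i j => ?_
  rw [christoffelMap_single, sum_apply, Finset.sum_eq_single i, sum_apply, sum_apply,
    Finset.sum_eq_single j]
  · simp
  · intro b _ hb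
    simp [hb]
  · simp
  · intro b _ hb
    simp [hb]
  · simp

theorem contMDiffOn_christoffelMap [T2Space M] (cov : LinearConnection m M)
    [cov.ContMDiffCovariantDerivative ∞]
    (hφ : φ ∈ IsManifold.maximalAtlas 𝓘(ℝ, EuclideanSpace ℝ (Fin m)) ∞ M) :
    ContMDiffOn 𝓘(ℝ, EuclideanSpace ℝ (Fin m)) 𝓘(ℝ, EuclideanSpace ℝ (Fin m) →L[ℝ]
      EuclideanSpace ℝ (Fin m) →L[ℝ] EuclideanSpace ℝ (Fin m)) ∞
      (christoffelMap cov φ) φ.source := by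
  intro x hx
  refine ContMDiffAt.contMDiffWithinAt ?_
  simp only [funext (christoffelMap_eq_sum cov φ)]
  refine contMDiffAt_finsetSum fun i _ => contMDiffAt_finsetSum fun j _ => ?_
  exact (ContinuousLinearMap.contMDiff _).contMDiffAt.comp x
    ((ContinuousLinearMap.contMDiff _).contMDiffAt.comp x
      (contMDiffAt_chartDeriv_field hφ hx (smoothFieldAt_cov_coordField cov hφ hx i j)))

end Christoffel

/-! ### The exchange in coordinates and changes of natural coordinates. -/

section SecondOrder

variable {X F : Type*} [NormedAddCommGroup X] [NormedSpace ℝ X]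
  [NormedAddCommGroup F] [NormedSpace ℝ F]

/-- The exchange map in coordinates. -/
def exchangeCoord (Γ : X →L[ℝ] X →L[ℝ] X)
    (y : X × ((F × (X →L[ℝ] F)) × (X →L[ℝ] F × (X →L[ℝ] F)))) :
    X × ((F × (X →L[ℝ] F)) × (X →L[ℝ] F × (X →L[ℝ] F))) :=
  (y.1, ((y.2.1.1, (ContinuousLinearMap.fst ℝ F (X →L[ℝ] F)).comp y.2.2),
    y.2.1.2.prod
      (((ContinuousLinearMap.snd ℝ F (X →L[ℝ] F)).comp y.2.2).flip +
        (ContinuousLinearMap.compL ℝ X X F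
          ((ContinuousLinearMap.fst ℝ F (X →L[ℝ] F)).comp y.2.2 - y.2.1.2)).comp Γ)))

/-- The second application sees `A` and `β` swapped, so its correction has the opposite sign. The
first correction has meanwhile been transposed, and flipping `Γ` makes the two cancel. -/
theorem exchangeCoord_flip_exchangeCoord (Γ : X →L[ℝ] X →L[ℝ] X)
    (y : X × ((F × (X →L[ℝ] F)) × (X →L[ℝ] F × (X →L[ℝ] F)))) :
    exchangeCoord Γ.flip (exchangeCoord Γ y) = y := by
  obtain ⟨x, ⟨u, A⟩, B⟩ := y
  simp only [exchangeCoord, Prod.mk.injEq, true_and]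
  refine ⟨by ext; simp, ?_⟩
  refine ContinuousLinearMap.ext fun v => Prod.ext (by simp) ?_
  ext1 w
  simp
  abel

/-- The coordinates of the same iterated jet in two systems of natural coordinates. Here `T`, `T₂`
are the first two derivatives of the change of coordinates of `E`, and `b`, `b₂` those of the
inverse change of coordinates of `M`. -/
structure IsJetChange (T : X × F →L[ℝ] X × F) (T₂ : X × F →L[ℝ] X × F →L[ℝ] X × F)
    (b : X →L[ℝ] X) (b₂ : X →L[ℝ] X →L[ℝ] X) (p : X × F)
    (y y' : X × ((F × (X →L[ℝ] F)) × (X →L[ℝ] F × (X →L[ℝ] F)))) : Prop where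
  x_eq : y'.1 = p.1
  u_eq : y'.2.1.1 = p.2
  u₁_eq : ∀ η, y'.2.1.2 η = (T (b η, y.2.1.2 (b η))).2
  ubar_eq : ∀ η, (y'.2.2 η).1 = (T (b η, (y.2.2 (b η)).1)).2
  u₂_eq : ∀ η θ, (y'.2.2 η).2 θ =
    (T₂ (b η, (y.2.2 (b η)).1) (b θ, y.2.1.2 (b θ)) + T (0, (y.2.2 (b η)).2 (b θ)) +
      T (b₂ η θ, y.2.1.2 (b₂ η θ))).2

/-- Symmetry of `T₂` and `b₂` takes care of the transposition. What remains is `T (b₂ η θ, β (b₂ η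
θ))` against `T (b₂ η θ, A (b₂ η θ))`; the difference is `T (0, (β - A) (b₂ η θ))`, which `hΓ`
provides. -/
theorem IsJetChange.exchangeCoord {T : X × F →L[ℝ] X × F}
    {T₂ : X × F →L[ℝ] X × F →L[ℝ] X × F} {b : X →L[ℝ] X} {b₂ : X →L[ℝ] X →L[ℝ] X} {p : X × F}
    {Γ Γ' : X →L[ℝ] X →L[ℝ] X} (hT₂ : ∀ v w, T₂ v w = T₂ w v) (hb₂ : ∀ v w, b₂ v w = b₂ w v)
    (hΓ : ∀ v w, b (Γ' v w) = Γ (b v) (b w) + b₂ v w)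
    {y y' z z' : X × ((F × (X →L[ℝ] F)) × (X →L[ℝ] F × (X →L[ℝ] F)))}
    (hy : IsJetChange T T₂ b b₂ p y y') (hz : IsJetChange T T₂ b b₂ p z z')
    (h : z = exchangeCoord Γ y) : z' = exchangeCoord Γ' y' := by
  obtain ⟨x, ⟨u, A⟩, B⟩ := y
  obtain ⟨x', ⟨u', A'⟩, B'⟩ := y'
  obtain ⟨xz, ⟨uz, Az⟩, Bz⟩ := z'
  subst h
  obtain ⟨h1, h2, h3, h4, h5⟩ := hy
  obtain ⟨k1, k2, k3, k4, k5⟩ := hz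
  simp only [JetExchange.exchangeCoord, Prod.mk.injEq] at *
  refine ⟨k1.trans h1.symm, ⟨k2.trans h2.symm, ?_⟩, ?_⟩
  · ext1 η
    simp [k3, h4]
  · refine ContinuousLinearMap.ext fun η => Prod.ext ?_ ?_
    · simp [k4, h3]
    · ext1 θ
      -- Only these splittings of `T` are wanted. Read backwards, `e2` writes a vertical value as a
      -- difference of two values over the same base vector, so that both sides become sums of the
      -- same terms.
      have e1 : ∀ s t : F, T (0, s + t) = T (0, s) + T (0, t) := fun s t => by
        rw [← map_add]; simp
      have e2 : ∀ s t : F, ∀ v, T (v, s) - T (v, t) = T (0, s - t) := fun s t v => by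
        rw [← map_sub]; simp
      have e3 : ∀ (v v' : X) (L : X →L[ℝ] F), T (v + v', L (v + v')) = T (v, L v) + T (v', L v') :=
        fun v v' L => by rw [← map_add]; simp
      have e4 : ∀ v v' : X, T (v + v', (B (v + v')).1) = T (v, (B v).1) + T (v', (B v').1) :=
        fun v v' => by rw [← map_add]; simp
      simp [k5, h5, h3, h4, hΓ, e3, e4, e1, hT₂ (b η, A (b η)), hb₂ θ η, ← e2 _ _ (Γ (b η) (b θ)),
        -map_add]
      abel

/-- The derivative of a change of coordinates of a jet bundle. -/
theorem exists_hasFDerivAt_jetChange {τ : X × F → X × F} {Dτ : X × F → X × F →L[ℝ] X × F}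
    {Dβ : X → X →L[ℝ] X} {T : X × F →L[ℝ] X × F} {T₂ : X × F →L[ℝ] X × F →L[ℝ] X × F}
    {b₂ : X →L[ℝ] X →L[ℝ] X} {y : X × (F × (X →L[ℝ] F))}
    (hτ : HasFDerivAt τ T (y.1, y.2.1)) (hDτ : HasFDerivAt Dτ T₂ (y.1, y.2.1))
    (hDβ : HasFDerivAt Dβ b₂ (τ (y.1, y.2.1)).1) :
    ∃ G : X × (F × (X →L[ℝ] F)) →L[ℝ] X × (F × (X →L[ℝ] F)),
      HasFDerivAt (fun y : X × (F × (X →L[ℝ] F)) => ((τ (y.1, y.2.1)).1, ((τ (y.1, y.2.1)).2,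
        (ContinuousLinearMap.snd ℝ X F).comp ((Dτ (y.1, y.2.1)).comp
          (((ContinuousLinearMap.id ℝ X).prod y.2.2).comp (Dβ (τ (y.1, y.2.1)).1)))))) G y ∧
      ∀ ξ μ H, (G (ξ, (μ, H))).1 = (T (ξ, μ)).1 ∧ (G (ξ, (μ, H))).2.1 = (T (ξ, μ)).2 ∧
        ∀ θ, (G (ξ, (μ, H))).2.2 θ =
          (T₂ (ξ, μ) (Dβ (τ (y.1, y.2.1)).1 θ, y.2.2 (Dβ (τ (y.1, y.2.1)).1 θ)) +
            Dτ (y.1, y.2.1) (0, H (Dβ (τ (y.1, y.2.1)).1 θ)) +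
            Dτ (y.1, y.2.1) (b₂ (T (ξ, μ)).1 θ, y.2.2 (b₂ (T (ξ, μ)).1 θ))).2 := by
  have hq : HasFDerivAt (fun y : X × (F × (X →L[ℝ] F)) => (y.1, y.2.1))
      ((ContinuousLinearMap.fst ℝ X (F × (X →L[ℝ] F))).prod
        ((ContinuousLinearMap.fst ℝ F (X →L[ℝ] F)).comp
          (ContinuousLinearMap.snd ℝ X (F × (X →L[ℝ] F))))) y :=
    ContinuousLinearMap.hasFDerivAt ((ContinuousLinearMap.fst ℝ X (F × (X →L[ℝ] F))).prod
        ((ContinuousLinearMap.fst ℝ F (X →L[ℝ] F)).comp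
          (ContinuousLinearMap.snd ℝ X (F × (X →L[ℝ] F)))))
  have h1 := hτ.comp y hq
  have h2 := hDτ.comp y hq
  have h3 := HasFDerivAt.comp y (g := Dβ) hDβ h1.fst
  have h4 : HasFDerivAt (fun y : X × (F × (X →L[ℝ] F)) => (ContinuousLinearMap.id ℝ X).prod y.2.2)
      ((ContinuousLinearMap.compL ℝ X F (X × F) (ContinuousLinearMap.inr ℝ X F)).comp
        ((ContinuousLinearMap.snd ℝ F (X →L[ℝ] F)).comp
          (ContinuousLinearMap.snd ℝ X (F × (X →L[ℝ] F))))) y := by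
    have : (fun y : X × (F × (X →L[ℝ] F)) => (ContinuousLinearMap.id ℝ X).prod y.2.2) =
        fun y => (ContinuousLinearMap.inl ℝ X F) +
          ((ContinuousLinearMap.compL ℝ X F (X × F) (ContinuousLinearMap.inr ℝ X F)).comp
            ((ContinuousLinearMap.snd ℝ F (X →L[ℝ] F)).comp
              (ContinuousLinearMap.snd ℝ X (F × (X →L[ℝ] F))))) y := by
      funext y; ext v <;> simp
    rw [this]
    exact (ContinuousLinearMap.hasFDerivAt _).const_add _
  have h5 := (hasFDerivAt_const (ContinuousLinearMap.snd ℝ X F) y).clm_comp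
    (h2.clm_comp (h4.clm_comp h3))
  refine ⟨_, h1.fst.prodMk (h1.snd.prodMk h5), fun ξ μ H => ⟨?_, ?_, fun θ => ?_⟩⟩
  · simp
  · simp
  · simp
    abel

variable {M E : Type*} [TopologicalSpace M] [ChartedSpace X M]
  [TopologicalSpace E] [ChartedSpace (X × F) E] {π : E → M}
  [IsManifold 𝓘(ℝ, X) ∞ M] [IsManifold 𝓘(ℝ, X × F) ∞ E] [IsFibration X F π]

namespace FiberedChart

variable (c c' : FiberedChart X F π)

/-- Both charts lie over charts of the base, so the first component of the derivative is that of the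
base change, whatever the vertical part `s`; the inner derivative of the inverse base change undoes
it. -/
theorem fst_fderiv_transition {p : E} (hp : p ∈ c.total.source) (hp' : p ∈ c'.total.source)
    (η : X) (s : F) :
    (fderiv ℝ (c'.total ∘ c.total.symm) (c.total p)
      (fderiv ℝ (c.base ∘ c'.base.symm) (c'.base (π p)) η, s)).1 = η := by
  have hb := isInvertible_chartDeriv c.base_mem (c.mapsTo p hp)
  have hb' := isInvertible_chartDeriv c'.base_mem (c'.mapsTo p hp')
  have ht := isInvertible_chartDeriv c.total_mem hp
  rw [← chartDeriv_comp_inverse c.total_mem c'.total_mem hp hp',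
    ← chartDeriv_comp_inverse c'.base_mem c.base_mem (c'.mapsTo p hp') (c.mapsTo p hp)]
  set v : TangentSpace 𝓘(ℝ, X × F) p := (chartDeriv c.total p).inverse
    (((chartDeriv c.base (π p)).comp (chartDeriv c'.base (π p)).inverse) η, s) with hv
  have h1 : chartDeriv c.base (π p) (mfderiv 𝓘(ℝ, X × F) 𝓘(ℝ, X) π p v) =
      (chartDeriv c.total p v).1 := congrArg (fun L => L v) (c.base_comp_deriv hp)
  have h2 : chartDeriv c'.base (π p) (mfderiv 𝓘(ℝ, X × F) 𝓘(ℝ, X) π p v) =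
      (chartDeriv c'.total p v).1 := congrArg (fun L => L v) (c'.base_comp_deriv hp')
  rw [ContinuousLinearMap.comp_apply, ← hv]
  have h3 : (chartDeriv c.total p v).1 =
      chartDeriv c.base (π p) ((chartDeriv c'.base (π p)).inverse η) := by
    rw [hv, ht.self_apply_inverse]; rfl
  have h4 := hb.injective (h1.trans h3)
  refine h2.symm.trans ?_
  refine (congrArg _ h4).trans ?_
  exact hb'.self_apply_inverse η

theorem mem_transition_source {V N : Type*} [TopologicalSpace V] [TopologicalSpace N]
    {e e' : OpenPartialHomeomorph N V} {p : N} (hp : p ∈ e.source) (hp' : p ∈ e'.source) :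
    e p ∈ (e.symm ≫ₕ e').source := by
  simp [hp', e.left_inv hp, e.map_source hp]

theorem contDiffAt_transition {V : Type*} [NormedAddCommGroup V] [NormedSpace ℝ V]
    {N : Type*} [TopologicalSpace N] [ChartedSpace V N] [IsManifold 𝓘(ℝ, V) ∞ N]
    {e e' : OpenPartialHomeomorph N V} (he : e ∈ IsManifold.maximalAtlas 𝓘(ℝ, V) ∞ N)
    (he' : e' ∈ IsManifold.maximalAtlas 𝓘(ℝ, V) ∞ N) {p : N} (hp : p ∈ e.source)
    (hp' : p ∈ e'.source) : ContDiffAt ℝ ∞ (e' ∘ e.symm) (e p) :=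
  (contDiffOn_transition he he').contDiffAt
    ((e.symm ≫ₕ e').open_source.mem_nhds (mem_transition_source hp hp'))

theorem hasFDerivAt_fderiv_transition {V : Type*} [NormedAddCommGroup V] [NormedSpace ℝ V]
    {N : Type*} [TopologicalSpace N] [ChartedSpace V N] [IsManifold 𝓘(ℝ, V) ∞ N]
    {e e' : OpenPartialHomeomorph N V} (he : e ∈ IsManifold.maximalAtlas 𝓘(ℝ, V) ∞ N)
    (he' : e' ∈ IsManifold.maximalAtlas 𝓘(ℝ, V) ∞ N) {p : N} (hp : p ∈ e.source)
    (hp' : p ∈ e'.source) :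
    HasFDerivAt (fderiv ℝ (e' ∘ e.symm)) (fderiv ℝ (fderiv ℝ (e' ∘ e.symm)) (e p)) (e p) :=
  (((contDiffAt_transition he he' hp hp').fderiv_right (m := ∞) (by simp)).differentiableAt
    (by simp)).hasFDerivAt

theorem fderiv_fderiv_transition_symm {V : Type*} [NormedAddCommGroup V] [NormedSpace ℝ V]
    {N : Type*} [TopologicalSpace N] [ChartedSpace V N] [IsManifold 𝓘(ℝ, V) ∞ N]
    {e e' : OpenPartialHomeomorph N V} (he : e ∈ IsManifold.maximalAtlas 𝓘(ℝ, V) ∞ N)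
    (he' : e' ∈ IsManifold.maximalAtlas 𝓘(ℝ, V) ∞ N) {p : N} (hp : p ∈ e.source)
    (hp' : p ∈ e'.source) (v w : V) :
    fderiv ℝ (fderiv ℝ (e' ∘ e.symm)) (e p) v w = fderiv ℝ (fderiv ℝ (e' ∘ e.symm)) (e p) w v :=
  ((contDiffAt_transition he he' hp hp').isSymmSndFDerivAt
    (by simpa using (WithTop.coe_le_coe.2 (le_top : (2 : ℕ∞) ≤ ⊤) : (2 : ℕ∞ω) ≤ ∞))) v w

/-- The change of natural coordinates of `J¹π₁`. -/
theorem isJetChange_jetCoord (w : IteratedJet X F π) (hw : w.pt.pt ∈ c.total.source)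
    (hw' : w.pt.pt ∈ c'.total.source) :
    IsJetChange (fderiv ℝ (c'.total ∘ c.total.symm) (c.total w.pt.pt))
      (fderiv ℝ (fderiv ℝ (c'.total ∘ c.total.symm)) (c.total w.pt.pt))
      (fderiv ℝ (c.base ∘ c'.base.symm) (c'.base (π w.pt.pt)))
      (fderiv ℝ (fderiv ℝ (c.base ∘ c'.base.symm)) (c'.base (π w.pt.pt)))
      (c'.total w.pt.pt) (c.jet.jetCoord w) (c'.jet.jetCoord w) := by
  have hz : w.pt ∈ c.jet.total.source := hw
  have hz' : w.pt ∈ c'.jet.total.source := hw'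
  -- The first-order law, applied one level up to the adapted charts `c.jet` and `c'.jet` of π₁. It
  -- involves the derivative of the change of coordinates of J¹π, which is computed as `G` below.
  have e1 := c.jet.jet_transition c'.jet (y := c.jet.jetCoord w) (c.jet.total.map_source hz)
    (by rwa [show (((c.jet.jetCoord w).1, (c.jet.jetCoord w).2.1)) = c.jet.total w.pt from rfl,
      c.jet.total.left_inv hz])
  rw [c.jet.jetOfCoord_jetCoord hz] at e1
  have e2 : c.jet.total.symm ((c.jet.jetCoord w).1, (c.jet.jetCoord w).2.1) = w.pt :=
    c.jet.total.left_inv hz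
  rw [e2] at e1
  have hq : ((c.jetCoord w.pt).1, (c.jetCoord w.pt).2.1) = c.total w.pt.pt :=
    Prod.ext (c.fst_eq _ hw).symm rfl
  have hp1 : ((c'.total ∘ c.total.symm) (c.total w.pt.pt)) = c'.total w.pt.pt := by
    simp [c.total.left_inv hw]
  obtain ⟨G, hG, hG'⟩ := exists_hasFDerivAt_jetChange (τ := c'.total ∘ c.total.symm)
    (Dτ := fderiv ℝ (c'.total ∘ c.total.symm)) (Dβ := fderiv ℝ (c.base ∘ c'.base.symm))
    (T := fderiv ℝ (c'.total ∘ c.total.symm) (c.total w.pt.pt))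
    (T₂ := fderiv ℝ (fderiv ℝ (c'.total ∘ c.total.symm)) (c.total w.pt.pt))
    (b₂ := fderiv ℝ (fderiv ℝ (c.base ∘ c'.base.symm)) (c'.base (π w.pt.pt)))
    (y := c.jetCoord w.pt)
    (by
      rw [hq]
      exact ((contDiffAt_transition c.total_mem c'.total_mem hw hw').differentiableAt
        (by simp)).hasFDerivAt)
    (by
      rw [hq]
      exact hasFDerivAt_fderiv_transition c.total_mem c'.total_mem hw hw')
    (by
      rw [hq, hp1, c'.fst_eq _ hw']
      exact hasFDerivAt_fderiv_transition c'.base_mem c.base_mem (c'.mapsTo _ hw') (c.mapsTo _ hw))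
  rw [hq, hp1, c'.fst_eq _ hw'] at hG'
  have hG1 : fderiv ℝ (c'.jet.total ∘ c.jet.total.symm)
      ((c.jet.jetCoord w).1, (c.jet.jetCoord w).2.1) = G := by
    refine HasFDerivAt.fderiv (hG.congr_of_eventuallyEq ?_)
    filter_upwards [(c.isOpen_jet_transition c').mem_nhds
      (show c.jetCoord w.pt ∈ (c.jetPartialEquiv.symm.trans c'.jetPartialEquiv).source by
        rw [jet_transition_source, mem_preimage, hq]
        exact mem_transition_source hw hw')] with y hy
    rw [jet_transition_source] at hy
    simp only [mem_preimage, OpenPartialHomeomorph.trans_source,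
      OpenPartialHomeomorph.symm_source, mem_inter_iff] at hy
    exact c.jet_transition c' hy.1 hy.2
  rw [hG1] at e1
  have hb1 : (c'.jet.total w.pt).1 = c'.base (π w.pt.pt) := rfl
  rw [hb1] at e1
  have hfst := c.fst_fderiv_transition c' hw hw'
  have e3 : c'.jetCoord w.pt = _ :=
    (congrArg c'.jetCoord (c.jetOfCoord_jetCoord hw).symm).trans
    (c.jet_transition c' (y := c.jetCoord w.pt) (by rw [hq]; exact c.total.map_source hw)
      (by rw [hq, c.total.left_inv hw]; exact hw'))
  rw [hq, c.total.left_inv hw, c'.fst_eq _ hw'] at e3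
  have hB : ∀ η, (c'.jet.jetCoord w).2.2 η =
      (G (fderiv ℝ (c.base ∘ c'.base.symm) (c'.base (π w.pt.pt)) η,
        (c.jet.jetCoord w).2.2 (fderiv ℝ (c.base ∘ c'.base.symm) (c'.base (π w.pt.pt)) η))).2 :=
    fun η => congrArg (fun y => y.2.2 η) e1
  refine ⟨(c'.fst_eq _ hw').symm, rfl, fun η => ?_, fun η => ?_, fun η θ => ?_⟩
  · exact congrArg (fun y => y.2.2 η) e3
  · rw [hB]
    exact (hG' _ _ _).2.1
  · rw [hB]
    refine ((hG' _ _ _).2.2 θ).trans ?_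
    -- In `hG'` the tensor `b₂` is evaluated at the base component of the transformed vector, which
    -- is `η` itself.
    rw [hfst]
    rfl

end FiberedChart

end SecondOrder

/-! ### The prolongation in coordinates, and smoothness of maps with the exchange expression. -/

section Prolong

variable {X F : Type*} [NormedAddCommGroup X] [NormedSpace ℝ X]
  [NormedAddCommGroup F] [NormedSpace ℝ F]
  {M E : Type*} [TopologicalSpace M] [ChartedSpace X M]
  [TopologicalSpace E] [ChartedSpace (X × F) E] {π : E → M}
  [IsManifold 𝓘(ℝ, X) ∞ M] [IsManifold 𝓘(ℝ, X × F) ∞ E] [IsFibration X F π]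

namespace FiberedChart

variable (c : FiberedChart X F π)

/-- In the charts `c.jet` and `c` the projection π_{1,0} is the linear map forgetting the slope,
hence its own derivative. -/
theorem chartDeriv_comp_mfderiv_pt {z : Jet1 X F π} (hz : z.pt ∈ c.total.source) :
    (chartDeriv c.total z.pt).comp
        (mfderiv 𝓘(ℝ, X × (F × (X →L[ℝ] F))) 𝓘(ℝ, X × F) Jet1.pt z) =
      ((ContinuousLinearMap.fst ℝ X (F × (X →L[ℝ] F))).prod
        ((ContinuousLinearMap.fst ℝ F (X →L[ℝ] F)).comp
          (ContinuousLinearMap.snd ℝ X (F × (X →L[ℝ] F))))).comp (chartDeriv c.jet.total z) := by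
  have hz' : z ∈ c.jet.total.source := hz
  have h1 := mfderiv_comp z
    ((mdifferentiable_of_mem_maximalAtlas c.total_mem).mdifferentiableAt hz)
    ((Jet1.contMDiff_pt (X := X) (F := F) z).mdifferentiableAt (by simp))
  have h2 := mfderiv_comp z (I'' := 𝓘(ℝ, X × F))
    (g := (ContinuousLinearMap.fst ℝ X (F × (X →L[ℝ] F))).prod
        ((ContinuousLinearMap.fst ℝ F (X →L[ℝ] F)).comp
          (ContinuousLinearMap.snd ℝ X (F × (X →L[ℝ] F)))))
    (ContinuousLinearMap.mdifferentiableAt _)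
    ((mdifferentiable_of_mem_maximalAtlas c.jet.total_mem).mdifferentiableAt hz')
  have h3 : c.total ∘ Jet1.pt =ᶠ[𝓝 z] ((ContinuousLinearMap.fst ℝ X (F × (X →L[ℝ] F))).prod
        ((ContinuousLinearMap.fst ℝ F (X →L[ℝ] F)).comp
          (ContinuousLinearMap.snd ℝ X (F × (X →L[ℝ] F))))) ∘ c.jet.total := by
    filter_upwards [c.jet.total.open_source.mem_nhds hz'] with q hq
    exact Prod.ext (c.fst_eq _ hq) rfl
  rw [h3.mfderiv_eq, h2, ContinuousLinearMap.mfderiv_eq] at h1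
  exact h1.symm

/-- The coordinate expression of the prolongation `j¹(π_{1,0})`. -/
theorem jetCoord_prolong {w : IteratedJet X F π} (hw : w.pt.pt ∈ c.total.source) :
    c.jetCoord w.prolong = ((c.jet.jetCoord w).1, ((c.jet.jetCoord w).2.1.1,
      (ContinuousLinearMap.fst ℝ F (X →L[ℝ] F)).comp (c.jet.jetCoord w).2.2)) := by
  refine Prod.ext rfl (Prod.ext rfl ?_)
  refine ContinuousLinearMap.ext fun v => ?_
  exact congrArg (fun L => (L (w.jet.lin ((chartDeriv c.base (π w.pt.pt)).inverse v))).2)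
    (c.chartDeriv_comp_mfderiv_pt hw)

theorem jetCoord_injOn {z z' : Jet1 X F π} (hz : z.pt ∈ c.total.source)
    (hz' : z'.pt ∈ c.total.source) (h : c.jetCoord z = c.jetCoord z') : z = z' := by
  rw [← c.jetOfCoord_jetCoord hz, h, c.jetOfCoord_jetCoord hz']

theorem pt_eq_of_jetCoord {z z' : Jet1 X F π} (hz : z.pt ∈ c.total.source)
    (hz' : z'.pt ∈ c.total.source) (h1 : (c.jetCoord z).1 = (c.jetCoord z').1)
    (h2 : (c.jetCoord z).2.1 = (c.jetCoord z').2.1) : z.pt = z'.pt := by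
  refine c.total.injOn hz hz' (Prod.ext ?_ h2)
  rw [c.fst_eq _ hz, c.fst_eq _ hz']
  exact h1

end FiberedChart

/-- Joint smoothness is needed because `Γ` varies with the base point. The expression is polynomial
in `Γ` and the coordinates, once `flip` and `prod` are written through fixed continuous linear maps.
-/
theorem contDiff_exchangeCoord :
    ContDiff ℝ ∞ (fun p : (X →L[ℝ] X →L[ℝ] X) ×
      (X × ((F × (X →L[ℝ] F)) × (X →L[ℝ] F × (X →L[ℝ] F)))) => exchangeCoord p.1 p.2) := by
  have h1 : (fun p : (X →L[ℝ] X →L[ℝ] X) ×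
      (X × ((F × (X →L[ℝ] F)) × (X →L[ℝ] F × (X →L[ℝ] F)))) => exchangeCoord p.1 p.2) = fun p =>
      (p.2.1, ((p.2.2.1.1, (ContinuousLinearMap.fst ℝ F (X →L[ℝ] F)).comp p.2.2.2),
        (ContinuousLinearMap.inl ℝ F (X →L[ℝ] F)).comp p.2.2.1.2 +
        (ContinuousLinearMap.inr ℝ F (X →L[ℝ] F)).comp
          (ContinuousLinearMap.flipₗᵢ ℝ X X F
            ((ContinuousLinearMap.snd ℝ F (X →L[ℝ] F)).comp p.2.2.2) +
          (ContinuousLinearMap.compL ℝ X X F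
            ((ContinuousLinearMap.fst ℝ F (X →L[ℝ] F)).comp p.2.2.2 - p.2.2.1.2)).comp p.1))) := by
    funext p
    refine Prod.ext rfl (Prod.ext rfl ?_)
    refine ContinuousLinearMap.ext fun v => Prod.ext ?_ ?_
    · simp [exchangeCoord]
    · ext1 w
      simp [exchangeCoord]
  rw [h1]
  have hB : ContDiff ℝ ∞ (fun p : (X →L[ℝ] X →L[ℝ] X) ×
      (X × ((F × (X →L[ℝ] F)) × (X →L[ℝ] F × (X →L[ℝ] F)))) => p.2.2.2) := by fun_prop
  have hA : ContDiff ℝ ∞ (fun p : (X →L[ℝ] X →L[ℝ] X) ×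
      (X × ((F × (X →L[ℝ] F)) × (X →L[ℝ] F × (X →L[ℝ] F)))) => p.2.2.1.2) := by fun_prop
  have h2 := (contDiff_const (c := ContinuousLinearMap.fst ℝ F (X →L[ℝ] F))).clm_comp hB
  have h3 := (contDiff_const (c := ContinuousLinearMap.snd ℝ F (X →L[ℝ] F))).clm_comp hB
  have hfl : ContDiff ℝ ∞ (fun L : X →L[ℝ] X →L[ℝ] F => ContinuousLinearMap.flipₗᵢ ℝ X X F L) :=
    IsBoundedLinearMap.contDiff ⟨⟨fun _ _ => rfl, fun _ _ => rfl⟩, 1, one_pos, fun L => by simp⟩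
  have h4 := hfl.comp h3
  have h5 := (ContinuousLinearMap.contDiff (E := X →L[ℝ] F) (F := (X →L[ℝ] X) →L[ℝ] X →L[ℝ] F)
    (ContinuousLinearMap.compL ℝ X X F) (n := ∞)).comp (h2.sub hA)
  have h6 := h5.clm_comp (contDiff_fst (𝕜 := ℝ) (n := ∞) (E := X →L[ℝ] X →L[ℝ] X)
    (F := X × ((F × (X →L[ℝ] F)) × (X →L[ℝ] F × (X →L[ℝ] F)))))
  have h7 := ((contDiff_const (c := ContinuousLinearMap.inl ℝ F (X →L[ℝ] F))).clm_comp hA).add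
    ((contDiff_const (c := ContinuousLinearMap.inr ℝ F (X →L[ℝ] F))).clm_comp (h4.add h6))
  have h8 : ContDiff ℝ ∞ (fun p : (X →L[ℝ] X →L[ℝ] X) ×
      (X × ((F × (X →L[ℝ] F)) × (X →L[ℝ] F × (X →L[ℝ] F)))) => p.2.1) := by fun_prop
  have h9 : ContDiff ℝ ∞ (fun p : (X →L[ℝ] X →L[ℝ] X) ×
      (X × ((F × (X →L[ℝ] F)) × (X →L[ℝ] F × (X →L[ℝ] F)))) => p.2.2.1.1) := by fun_prop
  exact h8.prodMk ((h9.prodMk h2).prodMk h7)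

theorem contMDiffOn_exchangeCoord {V N : Type*} [NormedAddCommGroup V] [NormedSpace ℝ V]
    [TopologicalSpace N] [ChartedSpace V N] {Γ : N → X →L[ℝ] X →L[ℝ] X}
    {f : N → X × ((F × (X →L[ℝ] F)) × (X →L[ℝ] F × (X →L[ℝ] F)))} {s : Set N}
    (hΓ : ContMDiffOn 𝓘(ℝ, V) 𝓘(ℝ, X →L[ℝ] X →L[ℝ] X) ∞ Γ s)
    (hf : ContMDiffOn 𝓘(ℝ, V) 𝓘(ℝ, X × ((F × (X →L[ℝ] F)) × (X →L[ℝ] F × (X →L[ℝ] F)))) ∞ f s) :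
    ContMDiffOn 𝓘(ℝ, V) 𝓘(ℝ, X × ((F × (X →L[ℝ] F)) × (X →L[ℝ] F × (X →L[ℝ] F)))) ∞
      (fun w => exchangeCoord (Γ w) (f w)) s :=
  contDiff_exchangeCoord.contMDiff.comp_contMDiffOn (hΓ.prodMk_space hf)

theorem contMDiffOn_of_chart_comp {V N : Type*} [NormedAddCommGroup V] [NormedSpace ℝ V]
    [TopologicalSpace N] [ChartedSpace V N] [IsManifold 𝓘(ℝ, V) ∞ N]
    {e : OpenPartialHomeomorph N V} (he : e ∈ IsManifold.maximalAtlas 𝓘(ℝ, V) ∞ N) {f : N → N}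
    (hf : ∀ w ∈ e.source, f w ∈ e.source)
    (h : ContMDiffOn 𝓘(ℝ, V) 𝓘(ℝ, V) ∞ (fun w => e (f w)) e.source) :
    ContMDiffOn 𝓘(ℝ, V) 𝓘(ℝ, V) ∞ f e.source := by
  refine ((contMDiffOn_symm_of_mem_maximalAtlas he).comp h
    fun w hw => e.map_source (hf w hw)).congr fun w hw => ?_
  exact (e.left_inv (hf w hw)).symm

/-- A map of `J¹π₁` whose expression in coordinates is that of an exchange map is smooth. -/
theorem FiberedChart.contMDiffOn_of_jetCoord_eq (c : FiberedChart X F π)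
    {Γ : M → X →L[ℝ] X →L[ℝ] X}
    (hΓ : ContMDiffOn 𝓘(ℝ, X) 𝓘(ℝ, X →L[ℝ] X →L[ℝ] X) ∞ Γ c.base.source)
    {f : IteratedJet X F π → IteratedJet X F π}
    (hf : ∀ w : IteratedJet X F π, w.pt.pt ∈ c.total.source → (f w).pt.pt ∈ c.total.source ∧
      c.jet.jetCoord (f w) = exchangeCoord (Γ (π w.pt.pt)) (c.jet.jetCoord w)) :
    ContMDiffOn 𝓘(ℝ, X × ((F × (X →L[ℝ] F)) × (X →L[ℝ] F × (X →L[ℝ] F))))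
      𝓘(ℝ, X × ((F × (X →L[ℝ] F)) × (X →L[ℝ] F × (X →L[ℝ] F)))) ∞ f c.jet.jet.total.source := by
  refine contMDiffOn_of_chart_comp c.jet.jet.total_mem (fun w hw => (hf w hw).1) ?_
  have h3 : ContMDiffOn 𝓘(ℝ, X × ((F × (X →L[ℝ] F)) × (X →L[ℝ] F × (X →L[ℝ] F))))
      𝓘(ℝ, X →L[ℝ] X →L[ℝ] X) ∞ (fun w : IteratedJet X F π => Γ (π w.pt.pt))
      c.jet.jet.total.source :=
    hΓ.comp ((IsFibration.contMDiff (F := F) (π := π)).comp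
      (Jet1.contMDiff_pt.comp Jet1.contMDiff_pt)).contMDiffOn (fun w hw => c.mapsTo _ hw)
  exact (contMDiffOn_exchangeCoord h3 (contMDiffOn_of_mem_maximalAtlas c.jet.jet.total_mem)).congr
    fun w hw => (hf w hw).2

end Prolong

/-! ### The global exchange map: existence, uniqueness, inverse, smoothness, projections. -/

section Exchange

variable {m n : ℕ} {M E : Type*} [TopologicalSpace M]
  [ChartedSpace (EuclideanSpace ℝ (Fin m)) M] [IsManifold 𝓘(ℝ, EuclideanSpace ℝ (Fin m)) ∞ M]
  [TopologicalSpace E] [ChartedSpace (EuclideanSpace ℝ (Fin m) × EuclideanSpace ℝ (Fin n)) E]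
  [IsManifold 𝓘(ℝ, EuclideanSpace ℝ (Fin m) × EuclideanSpace ℝ (Fin n)) ∞ E]
  {π : E → M} [IsFibration (EuclideanSpace ℝ (Fin m)) (EuclideanSpace ℝ (Fin n)) π]
  {cov : LinearConnection m M}
  {ex : IteratedJet (EuclideanSpace ℝ (Fin m)) (EuclideanSpace ℝ (Fin n)) π →
      IteratedJet (EuclideanSpace ℝ (Fin m)) (EuclideanSpace ℝ (Fin n)) π}

theorem euclideanCLM_ext {V : Type*} [NormedAddCommGroup V] [NormedSpace ℝ V]
    {L L' : EuclideanSpace ℝ (Fin m) →L[ℝ] V}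
    (h : ∀ i, L (EuclideanSpace.single i 1) = L' (EuclideanSpace.single i 1)) : L = L' := by
  ext1 v
  rw [← (EuclideanSpace.basisFun (Fin m) ℝ).sum_repr v]
  simp [h, map_sum]

theorem clm_christoffelMap_single (L : EuclideanSpace ℝ (Fin m) →L[ℝ] EuclideanSpace ℝ (Fin n))
    (φ : OpenPartialHomeomorph M (EuclideanSpace ℝ (Fin m))) (x : M) (i j : Fin m) (α : Fin n) :
    L (christoffelMap cov φ x (EuclideanSpace.single i 1) (EuclideanSpace.single j 1)) α =
      ∑ k, L (EuclideanSpace.single k 1) α * christoffel cov φ x k i j := by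
  conv_lhs => rw [← (EuclideanSpace.basisFun (Fin m) ℝ).sum_repr (christoffelMap cov φ x
    (EuclideanSpace.single i 1) (EuclideanSpace.single j 1))]
  simp [map_sum, christoffelMap_single_apply, mul_comm]

/-- Passage from indices to linear maps. The derivative index j of u^α_ij is the outer argument of
the last coordinate, so u^α_ji corresponds to `flip` and Γ^k_ji to `Γ` at e_j, e_i. -/
theorem isExchangeMap_iff :
    IsExchangeMap cov ex ↔
      ∀ (c : FiberedChart (EuclideanSpace ℝ (Fin m)) (EuclideanSpace ℝ (Fin n)) π) w,
        w.pt.pt ∈ c.total.source → (ex w).pt.pt ∈ c.total.source ∧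
          c.jet.jetCoord (ex w) =
            exchangeCoord (christoffelMap cov c.base (π w.pt.pt)) (c.jet.jetCoord w) := by
  refine forall_congr' fun c => forall_congr' fun w => imp_congr_right fun hw =>
    and_congr_right fun _ => ?_
  constructor
  · rintro ⟨h1, h2, h3, h4, h5⟩
    refine Prod.ext (PiLp.ext h1) (Prod.ext (Prod.ext (PiLp.ext h2) ?_) ?_)
    · refine euclideanCLM_ext fun i => PiLp.ext fun α => h3 α i
    · refine euclideanCLM_ext fun j => Prod.ext (PiLp.ext fun α => h4 α j) ?_
      refine euclideanCLM_ext fun i => PiLp.ext fun α => ?_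
      refine (h5 α i j).trans ?_
      have hB := clm_christoffelMap_single (cov := cov)
        ((ContinuousLinearMap.fst ℝ _ _).comp (c.jet.jetCoord w).2.2) c.base (π w.pt.pt) j i α
      simp only [ContinuousLinearMap.comp_apply, ContinuousLinearMap.coe_fst'] at hB
      simp [exchangeCoord, clm_christoffelMap_single, FiberedChart.ubar, FiberedChart.u₁,
        FiberedChart.u₂, sub_mul, Finset.sum_sub_distrib, hB]
  · intro h
    refine ⟨fun i => ?_, fun α => ?_, fun α i => ?_, fun α j => ?_, fun α i j => ?_⟩
    · rw [FiberedChart.x, h]; rfl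
    · rw [FiberedChart.u, h]; rfl
    · rw [FiberedChart.u₁, h]; rfl
    · rw [FiberedChart.ubar, h]; rfl
    · rw [FiberedChart.u₂, h]
      have hB := clm_christoffelMap_single (cov := cov)
        ((ContinuousLinearMap.fst ℝ _ _).comp (c.jet.jetCoord w).2.2) c.base (π w.pt.pt) j i α
      simp only [ContinuousLinearMap.comp_apply, ContinuousLinearMap.coe_fst'] at hB
      simp [exchangeCoord, clm_christoffelMap_single, FiberedChart.ubar, FiberedChart.u₁,
        FiberedChart.u₂, sub_mul, Finset.sum_sub_distrib, hB]

/-- The coordinates x and u are kept and the image stays in the chart domain, where the chart is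
injective. -/
theorem IsExchangeMap.pt_pt (h : IsExchangeMap cov ex)
    (w : IteratedJet (EuclideanSpace ℝ (Fin m)) (EuclideanSpace ℝ (Fin n)) π) :
    (ex w).pt.pt = w.pt.pt := by
  obtain ⟨c, hc⟩ := IsFibration.exists_fiberedChart (X := EuclideanSpace ℝ (Fin m))
    (F := EuclideanSpace ℝ (Fin n)) (π := π) w.pt.pt
  obtain ⟨h1, h2⟩ := isExchangeMap_iff.1 h c w hc
  refine c.pt_eq_of_jetCoord h1 hc ?_ ?_
  · change (c.jet.jetCoord (ex w)).1 = _
    rw [h2]; rfl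
  · change (c.jet.jetCoord (ex w)).2.1.1 = _
    rw [h2]; rfl

variable (cov) in
/-- The point with the coordinates required by the exchange map. -/
theorem exists_exchange (w : IteratedJet (EuclideanSpace ℝ (Fin m)) (EuclideanSpace ℝ (Fin n)) π) :
    ∃ w' : IteratedJet (EuclideanSpace ℝ (Fin m)) (EuclideanSpace ℝ (Fin n)) π,
      ∀ c : FiberedChart (EuclideanSpace ℝ (Fin m)) (EuclideanSpace ℝ (Fin n)) π,
        w.pt.pt ∈ c.total.source → w'.pt.pt ∈ c.total.source ∧
          c.jet.jetCoord w' =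
            exchangeCoord (christoffelMap cov c.base (π w.pt.pt)) (c.jet.jetCoord w) := by
  obtain ⟨c, hc⟩ := IsFibration.exists_fiberedChart (X := EuclideanSpace ℝ (Fin m))
    (F := EuclideanSpace ℝ (Fin n)) (π := π) w.pt.pt
  set y := exchangeCoord (christoffelMap cov c.base (π w.pt.pt)) (c.jet.jetCoord w) with hy
  have hq : (y.1, y.2.1.1) = c.total w.pt.pt := Prod.ext (c.fst_eq _ hc).symm rfl
  have ht : (y.1, y.2.1) ∈ c.jet.total.target := by
    change (y.1, y.2.1.1) ∈ c.total.target
    rw [hq]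
    exact c.total.map_source hc
  have h1 := c.jet.jetCoord_jetOfCoord ht
  have hpt : (c.jet.jetOfCoord y).pt.pt = w.pt.pt := by
    rw [c.jet.jetOfCoord_pt]
    refine (c.jetOfCoord_pt (y.1, y.2.1)).trans ?_
    change c.total.symm (y.1, y.2.1.1) = _
    rw [hq, c.total.left_inv hc]
  refine ⟨c.jet.jetOfCoord y, fun c' hc' => ⟨by rwa [hpt], ?_⟩⟩
  have k1 := c.isJetChange_jetCoord c' w hc hc'
  have k2 := c.isJetChange_jetCoord c' (c.jet.jetOfCoord y) (by rwa [hpt]) (by rwa [hpt])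
  rw [hpt] at k2
  -- The point was defined through the single chart `c`; symmetry of second derivatives and the
  -- Christoffel law carry its expression over to `c'`.
  exact k1.exchangeCoord
    (FiberedChart.fderiv_fderiv_transition_symm c.total_mem c'.total_mem hc hc')
    (FiberedChart.fderiv_fderiv_transition_symm c'.base_mem c.base_mem (c'.mapsTo _ hc')
      (c.mapsTo _ hc))
    (christoffelMap_transition cov c.base_mem c'.base_mem (c.mapsTo _ hc) (c'.mapsTo _ hc')) k2
    (h1.trans hy)

variable (π cov) in
theorem existsUnique_isExchangeMap :
    ∃! ex : IteratedJet (EuclideanSpace ℝ (Fin m)) (EuclideanSpace ℝ (Fin n)) π →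
        IteratedJet (EuclideanSpace ℝ (Fin m)) (EuclideanSpace ℝ (Fin n)) π,
      IsExchangeMap cov ex := by
  choose ex hex using exists_exchange (n := n) (π := π) cov
  refine ⟨ex, isExchangeMap_iff.2 fun c w => hex w c, fun ex' h' => funext fun w => ?_⟩
  obtain ⟨c, hc⟩ := IsFibration.exists_fiberedChart (X := EuclideanSpace ℝ (Fin m))
    (F := EuclideanSpace ℝ (Fin n)) (π := π) w.pt.pt
  obtain ⟨h1, h2⟩ := isExchangeMap_iff.1 h' c w hc
  obtain ⟨h3, h4⟩ := hex w c hc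
  exact c.jet.jetCoord_injOn h1 h3 (h2.trans h4.symm)

theorem IsExchangeMap.addTorsion_comp
    {ex' : IteratedJet (EuclideanSpace ℝ (Fin m)) (EuclideanSpace ℝ (Fin n)) π →
      IteratedJet (EuclideanSpace ℝ (Fin m)) (EuclideanSpace ℝ (Fin n)) π}
    (h : IsExchangeMap cov ex) (h' : IsExchangeMap (addTorsion cov) ex')
    (w : IteratedJet (EuclideanSpace ℝ (Fin m)) (EuclideanSpace ℝ (Fin n)) π) :
    ex' (ex w) = w ∧ ex (ex' w) = w := by
  obtain ⟨c, hc⟩ := IsFibration.exists_fiberedChart (X := EuclideanSpace ℝ (Fin m))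
    (F := EuclideanSpace ℝ (Fin n)) (π := π) w.pt.pt
  have ht := christoffelMap_addTorsion cov c.base_mem (c.mapsTo _ hc)
  constructor
  · obtain ⟨h1, h2⟩ := isExchangeMap_iff.1 h c w hc
    obtain ⟨h3, h4⟩ := isExchangeMap_iff.1 h' c (ex w) h1
    refine c.jet.jetCoord_injOn h3 hc ?_
    rw [h4, h2, h.pt_pt, ht, exchangeCoord_flip_exchangeCoord]
  · obtain ⟨h1, h2⟩ := isExchangeMap_iff.1 h' c w hc
    obtain ⟨h3, h4⟩ := isExchangeMap_iff.1 h c (ex' w) h1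
    refine c.jet.jetCoord_injOn h3 hc ?_
    rw [h4, h2, h'.pt_pt, ht]
    -- The lemma is used for the flipped symbols, whose flip is the original `Γ`.
    exact exchangeCoord_flip_exchangeCoord _ _

/-- Smoothness is required of the Christoffel maps only, so that the statement also covers ∇ + T,
whose symbols are merely flipped. -/
theorem IsExchangeMap.contMDiff (h : IsExchangeMap cov ex)
    (hΓ : ∀ φ ∈ IsManifold.maximalAtlas 𝓘(ℝ, EuclideanSpace ℝ (Fin m)) ∞ M,
      ContMDiffOn 𝓘(ℝ, EuclideanSpace ℝ (Fin m)) 𝓘(ℝ, EuclideanSpace ℝ (Fin m) →L[ℝ]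
        EuclideanSpace ℝ (Fin m) →L[ℝ] EuclideanSpace ℝ (Fin m)) ∞
        (christoffelMap cov φ) φ.source) :
    ContMDiff 𝓘(ℝ, IteratedJetModel m n) 𝓘(ℝ, IteratedJetModel m n) ∞ ex := by
  intro w
  obtain ⟨c, hc⟩ := IsFibration.exists_fiberedChart (X := EuclideanSpace ℝ (Fin m))
    (F := EuclideanSpace ℝ (Fin n)) (π := π) w.pt.pt
  exact (c.contMDiffOn_of_jetCoord_eq (hΓ c.base c.base_mem)
    (isExchangeMap_iff.1 h c)).contMDiffAt (c.jet.jet.total.open_source.mem_nhds hc)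

theorem IsExchangeMap.pt_eq_prolong (h : IsExchangeMap cov ex)
    (w : IteratedJet (EuclideanSpace ℝ (Fin m)) (EuclideanSpace ℝ (Fin n)) π) :
    (ex w).pt = w.prolong := by
  obtain ⟨c, hc⟩ := IsFibration.exists_fiberedChart (X := EuclideanSpace ℝ (Fin m))
    (F := EuclideanSpace ℝ (Fin n)) (π := π) w.pt.pt
  obtain ⟨h1, h2⟩ := isExchangeMap_iff.1 h c w hc
  refine c.jetCoord_injOn h1 hc ?_
  rw [c.jetCoord_prolong hc]
  exact congrArg (fun y => (y.1, y.2.1)) h2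

theorem IsExchangeMap.prolong_eq_pt (h : IsExchangeMap cov ex)
    (w : IteratedJet (EuclideanSpace ℝ (Fin m)) (EuclideanSpace ℝ (Fin n)) π) :
    (ex w).prolong = w.pt := by
  obtain ⟨c, hc⟩ := IsFibration.exists_fiberedChart (X := EuclideanSpace ℝ (Fin m))
    (F := EuclideanSpace ℝ (Fin n)) (π := π) w.pt.pt
  obtain ⟨h1, h2⟩ := isExchangeMap_iff.1 h c w hc
  refine c.jetCoord_injOn h1 hc ?_
  rw [c.jetCoord_prolong h1, h2]
  rfl

end Exchange

/-! ### The two affine structures in natural coordinates. -/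

section Affine

variable {X F : Type*} [NormedAddCommGroup X] [NormedSpace ℝ X]
  [NormedAddCommGroup F] [NormedSpace ℝ F]
  {M E : Type*} [TopologicalSpace M] [ChartedSpace X M]
  [TopologicalSpace E] [ChartedSpace (X × F) E] {π : E → M}
  [IsManifold 𝓘(ℝ, X) ∞ M] [IsManifold 𝓘(ℝ, X × F) ∞ E] [IsFibration X F π]

namespace FiberedChart

variable (c : FiberedChart X F π)

theorem slope_lineMap {p : E} (a b : JetFiber X F π p) (t : ℝ) :
    c.slope (a.lineMap b t) = (1 - t) • c.slope a + t • c.slope b := by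
  ext v
  simp [slope, JetFiber.lineMap]

/-- On a fibre of π_{1,0} the slope is an injective affine coordinate. -/
theorem isAffineComb_iff {t : ℝ} {z₀ z₁ z : Jet1 X F π} (h : z₀.pt ∈ c.total.source) :
    Jet1.IsAffineComb t z₀ z₁ z ↔ z₁.pt = z₀.pt ∧ z.pt = z₀.pt ∧
      (c.jetCoord z).2.2 = (1 - t) • (c.jetCoord z₀).2.2 + t • (c.jetCoord z₁).2.2 := by
  constructor
  · rintro ⟨p, a, b, rfl, rfl, rfl⟩
    exact ⟨rfl, rfl, c.slope_lineMap a b t⟩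
  · obtain ⟨p, a⟩ := z₀
    obtain ⟨p₁, b⟩ := z₁
    obtain ⟨p₂, d⟩ := z
    rintro ⟨h1, h2, h3⟩
    dsimp only at h h1 h2
    subst h1 h2
    refine ⟨_, a, b, rfl, rfl, ?_⟩
    congr 1
    have h4 : c.slope d = c.slope (a.lineMap b t) := by
      rw [slope_lineMap]; exact h3
    rw [← c.ofSlope_slope _ h d, h4, c.ofSlope_slope]

theorem jetCoord_inj {z z' : Jet1 X F π} (hz : z.pt ∈ c.total.source) (hpt : z.pt = z'.pt)
    (h : (c.jetCoord z).2.2 = (c.jetCoord z').2.2) : z = z' := by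
  have hz' : z'.pt ∈ c.total.source := hpt ▸ hz
  rw [← c.jetOfCoord_jetCoord hz, ← c.jetOfCoord_jetCoord hz']
  congr 1
  refine Prod.ext ?_ (Prod.ext ?_ h)
  · simp [jetCoord, hpt]
  · simp [jetCoord, hpt]

/-- The linear map of `LocalSection.jet` is transported along x = π (s x); this removes the
transport. -/
theorem comp_cast_inverse {x y : M} (e : x = y) {p : E}
    (L : TangentSpace 𝓘(ℝ, X) x →L[ℝ] TangentSpace 𝓘(ℝ, X × F) p) (v : X) :
    (e ▸ L : TangentSpace 𝓘(ℝ, X) y →L[ℝ] TangentSpace 𝓘(ℝ, X × F) p)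
      ((chartDeriv c.base y).inverse v) = L ((chartDeriv c.base x).inverse v) := by
  subst e; rfl

/-- The coordinates of the jet of a local section are the derivatives of its expression. -/
theorem hasFDerivAt_jet (s : LocalSection X F π) {x : M} (hx : x ∈ s.dom)
    (h : s.toFun x ∈ c.total.source) :
    HasFDerivAt (fun y => (c.total (s.toFun (c.base.symm y))).2) (c.jetCoord (s.jet x hx)).2.2
      (c.base x) := by
  have hxb : x ∈ c.base.source := s.proj_eq x hx ▸ c.mapsTo _ h
  have hs : MDifferentiableAt 𝓘(ℝ, X) 𝓘(ℝ, X × F) s.toFun x :=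
    (s.contMDiffOn.contMDiffAt (s.isOpen_dom.mem_nhds hx)).mdifferentiableAt (by simp)
  have hb := mdifferentiable_of_mem_maximalAtlas c.base_mem
  have h1 : HasMFDerivAt 𝓘(ℝ, X) 𝓘(ℝ, X) c.base.symm (c.base x)
      (mfderiv 𝓘(ℝ, X) 𝓘(ℝ, X) c.base.symm (c.base x)) :=
    (hb.mdifferentiableAt_symm (c.base.map_source hxb)).hasMFDerivAt
  have h2 : HasMFDerivAt 𝓘(ℝ, X) 𝓘(ℝ, X × F) (s.toFun ∘ c.base.symm) (c.base x)
      ((mfderiv 𝓘(ℝ, X) 𝓘(ℝ, X × F) s.toFun x).comp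
        (mfderiv 𝓘(ℝ, X) 𝓘(ℝ, X) c.base.symm (c.base x))) := by
    refine HasMFDerivAt.comp (c.base x) ?_ h1
    rw [c.base.left_inv hxb]
    exact hs.hasMFDerivAt
  have ht : HasMFDerivAt 𝓘(ℝ, X × F) 𝓘(ℝ, X × F) c.total (s.toFun x)
      (chartDeriv c.total (s.toFun x)) :=
    ((mdifferentiable_of_mem_maximalAtlas c.total_mem).mdifferentiableAt h).hasMFDerivAt
  have h3 : HasMFDerivAt 𝓘(ℝ, X) 𝓘(ℝ, X × F) (c.total ∘ (s.toFun ∘ c.base.symm)) (c.base x)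
      ((chartDeriv c.total (s.toFun x)).comp ((mfderiv 𝓘(ℝ, X) 𝓘(ℝ, X × F) s.toFun x).comp
        (mfderiv 𝓘(ℝ, X) 𝓘(ℝ, X) c.base.symm (c.base x)))) := by
    refine HasMFDerivAt.comp (c.base x) ?_ h2
    rw [Function.comp_apply, c.base.left_inv hxb]
    exact ht
  have h4 := (HasMFDerivAt.hasFDerivAt h3).snd
  have hinv : ∀ v, (chartDeriv c.base x).inverse v =
      mfderiv 𝓘(ℝ, X) 𝓘(ℝ, X) c.base.symm (c.base x) v := by
    intro v
    have h5 : mfderiv 𝓘(ℝ, X) 𝓘(ℝ, X) c.base.symm (c.base x)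
        (chartDeriv c.base x ((chartDeriv c.base x).inverse v)) = (chartDeriv c.base x).inverse v :=
      congrArg (fun L => L ((chartDeriv c.base x).inverse v)) (hb.symm_comp_deriv hxb)
    rw [(isInvertible_chartDeriv c.base_mem hxb).self_apply_inverse] at h5
    exact h5.symm
  refine h4.congr_fderiv ?_
  refine ContinuousLinearMap.ext fun v => ?_
  have h7 := c.comp_cast_inverse (s.proj_eq x hx).symm
    (mfderiv 𝓘(ℝ, X) 𝓘(ℝ, X × F) s.toFun x) v
  rw [hinv] at h7
  exact congrArg (fun u => (chartDeriv c.total (s.toFun x) u).2) h7.symm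

theorem isOpen_affineSection_dom (u : F) (w : X →L[ℝ] F) (a : X) :
    IsOpen (c.base.source ∩ c.base ⁻¹' {y | (y, u + w (y - a)) ∈ c.total.target}) :=
  c.base.isOpen_inter_preimage (c.total.open_target.preimage (by fun_prop))

/-- The local section whose expression in coordinates is an affine function. -/
def affineSection (u : F) (w : X →L[ℝ] F) (a : X) : LocalSection X F π where
  dom := c.base.source ∩ c.base ⁻¹' {y | (y, u + w (y - a)) ∈ c.total.target}
  toFun x := c.total.symm (c.base x, u + w (c.base x - a))
  isOpen_dom := c.isOpen_affineSection_dom u w a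
  contMDiffOn := by
    have h1 : ContDiff ℝ ∞ (fun y : X => (y, u + w (y - a))) := by fun_prop
    exact (contMDiffOn_symm_of_mem_maximalAtlas c.total_mem).comp
      (h1.contMDiff.comp_contMDiffOn ((contMDiffOn_of_mem_maximalAtlas c.base_mem).mono
        inter_subset_left)) (fun x hx => hx.2)
  proj_eq x hx := by
    have h1 := c.total.map_target hx.2
    have h2 := c.fst_eq _ h1
    rw [c.total.right_inv hx.2] at h2
    exact (c.base.injOn hx.1 (c.mapsTo _ h1) h2).symm

theorem mem_affineSection_dom {z : Jet1 X F π} (hz : z.pt ∈ c.total.source) (w : X →L[ℝ] F) :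
    π z.pt ∈ (c.affineSection (c.total z.pt).2 w (c.base (π z.pt))).dom := by
  refine ⟨c.mapsTo _ hz, ?_⟩
  simp only [mem_preimage, mem_ofPred_eq, sub_self, map_zero, add_zero]
  rw [← c.fst_eq _ hz]
  exact c.total.map_source hz

/-- Every jet comes from a local section: `u + w (y - a)` has value `u` and derivative `w` at `a`.
This supplies the sections that an affine combination in the prolonged structure asks for. -/
theorem affineSection_jet {z : Jet1 X F π} (hz : z.pt ∈ c.total.source) :
    (c.affineSection (c.total z.pt).2 (c.jetCoord z).2.2 (c.base (π z.pt))).jet (π z.pt)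
      (c.mem_affineSection_dom hz _) = z := by
  have hpt : (c.affineSection (c.total z.pt).2 (c.jetCoord z).2.2 (c.base (π z.pt))).toFun
      (π z.pt) = z.pt := by
    simp only [affineSection, sub_self, map_zero, add_zero]
    rw [← c.fst_eq _ hz]
    exact c.total.left_inv hz
  have hs := hpt ▸ hz
  refine c.jetCoord_inj hs hpt ?_
  refine (c.hasFDerivAt_jet _ (c.mem_affineSection_dom hz _) hs).unique ?_
  have h1 : HasFDerivAt (fun y => (c.total z.pt).2 + (c.jetCoord z).2.2 (y - c.base (π z.pt)))
      (c.jetCoord z).2.2 (c.base (π z.pt)) := by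
    refine ((c.jetCoord z).2.2.hasFDerivAt.add_const ((c.total z.pt).2 -
      (c.jetCoord z).2.2 (c.base (π z.pt)))).congr_of_eventuallyEq (Eventually.of_forall fun y => ?_)
    simp only [map_sub]
    abel
  refine h1.congr_of_eventuallyEq ?_
  have h2 := (c.base.isOpen_inter_preimage_symm (c.isOpen_affineSection_dom (c.total z.pt).2
    (c.jetCoord z).2.2 (c.base (π z.pt)))).mem_nhds
    (show c.base (π z.pt) ∈ _ from ⟨c.base.map_source (c.mapsTo _ hz), by
      rw [mem_preimage, c.base.left_inv (c.mapsTo _ hz)]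
      exact c.mem_affineSection_dom hz _⟩)
  filter_upwards [h2] with y hy
  have h3 : (c.base (c.base.symm y), _) ∈ c.total.target := hy.2.2
  change (c.total (c.total.symm _)).2 = _
  rw [c.total.right_inv h3, c.base.right_inv hy.1]

/-- Affine combinations in the fibres of the prolongation of `π_{1,0}`, in coordinates. -/
theorem isProlongedAffineComb_iff {t : ℝ} {w₀ w₁ w : IteratedJet X F π}
    (h : w₀.pt.pt ∈ c.total.source) :
    IteratedJet.IsProlongedAffineComb t w₀ w₁ w ↔ w₁.pt.pt = w₀.pt.pt ∧ w.pt.pt = w₀.pt.pt ∧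
      (c.jet.jetCoord w).2.1.2 =
        (1 - t) • (c.jet.jetCoord w₀).2.1.2 + t • (c.jet.jetCoord w₁).2.1.2 ∧
      ∀ v, ((c.jet.jetCoord w₁).2.2 v).1 = ((c.jet.jetCoord w₀).2.2 v).1 ∧
        ((c.jet.jetCoord w).2.2 v).1 = ((c.jet.jetCoord w₀).2.2 v).1 ∧
        ((c.jet.jetCoord w).2.2 v).2 =
          (1 - t) • ((c.jet.jetCoord w₀).2.2 v).2 + t • ((c.jet.jetCoord w₁).2.2 v).2 := by
  constructor
  · rintro ⟨σ₀, σ₁, σ, x, h₀, h₁, h₂, hev, rfl, rfl, rfl⟩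
    have hx := (c.isAffineComb_iff h).1 hev.self_of_nhds
    have hs₀ : σ₀.toFun x ∈ c.jet.total.source := h
    have hs₁ : σ₁.toFun x ∈ c.jet.total.source := show (σ₁.toFun x).pt ∈ _ from hx.1 ▸ h
    have hs₂ : σ.toFun x ∈ c.jet.total.source := show (σ.toFun x).pt ∈ _ from hx.2.1 ▸ h
    have d₀ := c.jet.hasFDerivAt_jet σ₀ h₀ hs₀
    have d₁ := c.jet.hasFDerivAt_jet σ₁ h₁ hs₁
    have d := c.jet.hasFDerivAt_jet σ h₂ hs₂
    have hxb : x ∈ c.base.source := σ₀.proj_eq x h₀ ▸ c.mapsTo _ h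
    have hsrc : ∀ᶠ y in 𝓝 x, σ₀.toFun y ∈ c.jet.total.source :=
      (σ₀.contMDiffOn.continuousOn.continuousAt (σ₀.isOpen_dom.mem_nhds h₀)).eventually
        (c.jet.total.open_source.mem_nhds hs₀)
    have htend : Tendsto c.base.symm (𝓝 (c.base x)) (𝓝 x) := by
      simpa [c.base.left_inv hxb] using (c.base.continuousAt_symm (c.base.map_source hxb)).tendsto
    have key := htend.eventually (hsrc.and hev)
    -- The relations between the three sections hold near `x` and may be differentiated: equal u
    -- components give equal ū, and the combination of the u^α_i gives that of the u^α_ij.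
    have e₁ : (fun y => (c.jet.total (σ₁.toFun (c.jet.base.symm y))).2.1) =ᶠ[𝓝 (c.base x)]
        (fun y => (c.jet.total (σ₀.toFun (c.jet.base.symm y))).2.1) := by
      filter_upwards [key] with y hy
      have h3 := (c.isAffineComb_iff hy.1).1 hy.2
      exact congrArg (fun p => (c.total p).2) h3.1
    have e₂ : (fun y => (c.jet.total (σ.toFun (c.jet.base.symm y))).2.1) =ᶠ[𝓝 (c.base x)]
        (fun y => (c.jet.total (σ₀.toFun (c.jet.base.symm y))).2.1) := by
      filter_upwards [key] with y hy
      have h3 := (c.isAffineComb_iff hy.1).1 hy.2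
      exact congrArg (fun p => (c.total p).2) h3.2.1
    have e₃ : (fun y => (c.jet.total (σ.toFun (c.jet.base.symm y))).2.2) =ᶠ[𝓝 (c.base x)]
        (fun y => (1 - t) • (c.jet.total (σ₀.toFun (c.jet.base.symm y))).2.2 +
          t • (c.jet.total (σ₁.toFun (c.jet.base.symm y))).2.2) := by
      filter_upwards [key] with y hy
      exact ((c.isAffineComb_iff hy.1).1 hy.2).2.2
    refine ⟨hx.1, hx.2.1, hx.2.2, fun v => ⟨?_, ?_, ?_⟩⟩
    · exact congrArg (fun L => L v) ((d₁.fst.congr_of_eventuallyEq e₁.symm).unique d₀.fst)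
    · exact congrArg (fun L => L v) ((d.fst.congr_of_eventuallyEq e₂.symm).unique d₀.fst)
    · exact congrArg (fun L => L v) (d.snd.unique
        (((d₀.snd.const_smul (1 - t)).add (d₁.snd.const_smul t)).congr_of_eventuallyEq e₃))
  · rintro ⟨h1, h2, h3, h4⟩
    have hz₀ : w₀.pt ∈ c.jet.total.source := h
    have hz₁ : w₁.pt ∈ c.jet.total.source := show w₁.pt.pt ∈ _ from h1 ▸ h
    have hz : w.pt ∈ c.jet.total.source := show w.pt.pt ∈ _ from h2 ▸ h
    have b₁ : Jet1.proj w₁.pt = Jet1.proj w₀.pt := congrArg π h1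
    have b₂ : Jet1.proj w.pt = Jet1.proj w₀.pt := congrArg π h2
    have m₀ := c.jet.mem_affineSection_dom hz₀ (c.jet.jetCoord w₀).2.2
    have m₁ := c.jet.mem_affineSection_dom hz₁ (c.jet.jetCoord w₁).2.2
    have m := c.jet.mem_affineSection_dom hz (c.jet.jetCoord w).2.2
    have j₀ := c.jet.affineSection_jet hz₀
    have j₁ := c.jet.affineSection_jet hz₁
    have j := c.jet.affineSection_jet hz
    -- The three coordinate-affine sections are centred at the same point of `M`. The relations
    -- between their values and derivatives there then hold at all nearby points.
    simp only [b₁] at m₁ j₁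
    simp only [b₂] at m j
    refine ⟨_, _, _, Jet1.proj w₀.pt, m₀, m₁, m, ?_, j₀.symm, j₁.symm, j.symm⟩
    filter_upwards [(LocalSection.isOpen_dom _).mem_nhds m₀,
      (LocalSection.isOpen_dom _).mem_nhds m₁, (LocalSection.isOpen_dom _).mem_nhds m]
      with y hy₀ hy₁ hy
    have n₀ := hy₀.2
    have n₁ := hy₁.2
    have n := hy.2
    simp only [mem_preimage, mem_ofPred_eq] at n₀ n₁ n
    have r₀ := c.jet.total.right_inv n₀
    have r₁ := c.jet.total.right_inv n₁
    have r := c.jet.total.right_inv n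
    have p₀ : ((c.jet.affineSection (c.jet.total w₀.pt).2 (c.jet.jetCoord w₀).2.2
        (c.jet.base (Jet1.proj w₀.pt))).toFun y).pt = _ := c.jetOfCoord_pt _
    have p₁ : ((c.jet.affineSection (c.jet.total w₁.pt).2 (c.jet.jetCoord w₁).2.2
        (c.jet.base (Jet1.proj w₀.pt))).toFun y).pt = _ := c.jetOfCoord_pt _
    have p : ((c.jet.affineSection (c.jet.total w.pt).2 (c.jet.jetCoord w).2.2
        (c.jet.base (Jet1.proj w₀.pt))).toFun y).pt = _ := c.jetOfCoord_pt _
    have u₁ : (c.jet.total w₁.pt).2.1 = (c.jet.total w₀.pt).2.1 :=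
      congrArg (fun p => (c.total p).2) h1
    have u : (c.jet.total w.pt).2.1 = (c.jet.total w₀.pt).2.1 :=
      congrArg (fun p => (c.total p).2) h2
    have a : (c.jet.total w.pt).2.2 =
        (1 - t) • (c.jet.total w₀.pt).2.2 + t • (c.jet.total w₁.pt).2.2 := h3
    refine (c.isAffineComb_iff (c.jet.total.map_target n₀)).2 ⟨?_, ?_, ?_⟩
    · refine p₁.trans (Eq.trans ?_ p₀.symm)
      simp only [Prod.fst_add, u₁, (h4 _).1]
    · refine p.trans (Eq.trans ?_ p₀.symm)
      simp only [Prod.fst_add, u, (h4 _).2.1]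
    · refine (congrArg (fun q => q.2.2) r).trans (Eq.trans ?_ (congrArg₂ (fun q q' =>
        (1 - t) • q.2.2 + t • q'.2.2) r₀ r₁).symm)
      simp only [Prod.snd_add, a, (h4 _).2.2]
      module

end FiberedChart

/-- Affine combinations in a fibre of the iterated jet bundle, in coordinates. -/
theorem FiberedChart.isAffineComb_iterated_iff (c : FiberedChart X F π) {t : ℝ}
    {w₀ w₁ w : IteratedJet X F π} (h : w₀.pt.pt ∈ c.total.source) :
    Jet1.IsAffineComb t w₀ w₁ w ↔ w₁.pt.pt = w₀.pt.pt ∧ w.pt.pt = w₀.pt.pt ∧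
      (c.jet.jetCoord w₁).2.1.2 = (c.jet.jetCoord w₀).2.1.2 ∧
      (c.jet.jetCoord w).2.1.2 = (c.jet.jetCoord w₀).2.1.2 ∧
      (c.jet.jetCoord w).2.2 =
        (1 - t) • (c.jet.jetCoord w₀).2.2 + t • (c.jet.jetCoord w₁).2.2 := by
  rw [c.jet.isAffineComb_iff h]
  constructor
  · rintro ⟨h1, h2, h3⟩
    exact ⟨congrArg Jet1.pt h1, congrArg Jet1.pt h2,
      congrArg (fun z => (c.jetCoord z).2.2) h1, congrArg (fun z => (c.jetCoord z).2.2) h2, h3⟩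
  · rintro ⟨h1, h2, h3, h4, h5⟩
    exact ⟨c.jetCoord_inj (h1 ▸ h) h1 h3, c.jetCoord_inj (h2 ▸ h) h2 h4, h5⟩

end Affine

/-! ### Exchange of the affine structures, and the involution criterion. -/

section ExchangeAffine

variable {m n : ℕ} {M E : Type*} [TopologicalSpace M]
  [ChartedSpace (EuclideanSpace ℝ (Fin m)) M] [IsManifold 𝓘(ℝ, EuclideanSpace ℝ (Fin m)) ∞ M]
  [TopologicalSpace E] [ChartedSpace (EuclideanSpace ℝ (Fin m) × EuclideanSpace ℝ (Fin n)) E]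
  [IsManifold 𝓘(ℝ, EuclideanSpace ℝ (Fin m) × EuclideanSpace ℝ (Fin n)) ∞ E]
  {π : E → M} [IsFibration (EuclideanSpace ℝ (Fin m)) (EuclideanSpace ℝ (Fin n)) π]
  {cov : LinearConnection m M}
  {ex : IteratedJet (EuclideanSpace ℝ (Fin m)) (EuclideanSpace ℝ (Fin n)) π →
      IteratedJet (EuclideanSpace ℝ (Fin m)) (EuclideanSpace ℝ (Fin n)) π}

/-- Along such a combination `A` is constant and `B` affine, so `(β - A) ∘ Γ` is affine; after the
swap the constant `A` is the ū of the image. -/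
theorem IsExchangeMap.isProlongedAffineComb (h : IsExchangeMap cov ex) {t : ℝ}
    {w₀ w₁ w : IteratedJet (EuclideanSpace ℝ (Fin m)) (EuclideanSpace ℝ (Fin n)) π}
    (hw : Jet1.IsAffineComb t w₀ w₁ w) :
    IteratedJet.IsProlongedAffineComb t (ex w₀) (ex w₁) (ex w) := by
  obtain ⟨c, hc⟩ := IsFibration.exists_fiberedChart (X := EuclideanSpace ℝ (Fin m))
    (F := EuclideanSpace ℝ (Fin n)) (π := π) w₀.pt.pt
  obtain ⟨h1, h2, h3, h4, h5⟩ := (c.isAffineComb_iterated_iff hc).1 hw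
  obtain ⟨k₀, e₀⟩ := isExchangeMap_iff.1 h c w₀ hc
  obtain ⟨k₁, e₁⟩ := isExchangeMap_iff.1 h c w₁ (h1 ▸ hc)
  obtain ⟨k, e⟩ := isExchangeMap_iff.1 h c w (h2 ▸ hc)
  rw [h1] at e₁
  rw [h2] at e
  refine (c.isProlongedAffineComb_iff k₀).2 ⟨by rw [h.pt_pt, h.pt_pt, h1],
    by rw [h.pt_pt, h.pt_pt, h2], ?_, fun v => ⟨?_, ?_, ?_⟩⟩
  · rw [e, e₀, e₁]
    ext1 v
    simp [exchangeCoord, h5]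
  · rw [e₁, e₀]
    simp [exchangeCoord, h3]
  · rw [e, e₀]
    simp [exchangeCoord, h4]
  · rw [e, e₀, e₁]
    ext1 v
    simp [exchangeCoord, h5, h4, h3]
    module

/-- The mirror case: `β` is constant while `A` and `C` are affine. -/
theorem IsExchangeMap.isAffineComb (h : IsExchangeMap cov ex) {t : ℝ}
    {w₀ w₁ w : IteratedJet (EuclideanSpace ℝ (Fin m)) (EuclideanSpace ℝ (Fin n)) π}
    (hw : IteratedJet.IsProlongedAffineComb t w₀ w₁ w) :
    Jet1.IsAffineComb t (ex w₀) (ex w₁) (ex w) := by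
  obtain ⟨c, hc⟩ := IsFibration.exists_fiberedChart (X := EuclideanSpace ℝ (Fin m))
    (F := EuclideanSpace ℝ (Fin n)) (π := π) w₀.pt.pt
  obtain ⟨h1, h2, h3, h4⟩ := (c.isProlongedAffineComb_iff hc).1 hw
  have h5 := fun v => (h4 v).1
  have h6 := fun v => (h4 v).2.1
  have h7 := fun v => (h4 v).2.2
  obtain ⟨k₀, e₀⟩ := isExchangeMap_iff.1 h c w₀ hc
  obtain ⟨k₁, e₁⟩ := isExchangeMap_iff.1 h c w₁ (h1 ▸ hc)
  obtain ⟨k, e⟩ := isExchangeMap_iff.1 h c w (h2 ▸ hc)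
  rw [h1] at e₁
  rw [h2] at e
  refine (c.isAffineComb_iterated_iff k₀).2 ⟨by rw [h.pt_pt, h.pt_pt, h1],
    by rw [h.pt_pt, h.pt_pt, h2], ?_, ?_, ?_⟩
  · rw [e₁, e₀]
    ext1 v
    simp [exchangeCoord, h5]
  · rw [e, e₀]
    ext1 v
    simp [exchangeCoord, h6]
  · rw [e, e₀, e₁]
    refine ContinuousLinearMap.ext fun v => Prod.ext ?_ ?_
    · simp [exchangeCoord, h3]
    · ext1 u
      simp [exchangeCoord, h3, h5, h6, h7]
      module

/-- Symmetric symbols equal their flip, so `ex` plays the role of its own inverse. -/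
theorem isExchangeMap_addTorsion_of_torsion_eq_zero (h : IsExchangeMap cov ex)
    (hT : cov.torsion = 0) : IsExchangeMap (addTorsion cov) ex := by
  refine isExchangeMap_iff.2 fun c w hc => ?_
  have hx := c.mapsTo _ hc
  rw [christoffelMap_addTorsion cov c.base_mem hx,
    (torsion_eq_zero_iff_christoffelMap cov c.base_mem hx).1 (congrFun hT _)]
  exact isExchangeMap_iff.1 h c w hc

/-- Starting from `B = 0`, two applications produce `A (Γ w v - Γ v w)` in the second-order slot, so
every `A` kills this vector. -/
theorem flip_eq_of_exchangeCoord_involutive (hn : 1 ≤ n)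
    {Γ : EuclideanSpace ℝ (Fin m) →L[ℝ] EuclideanSpace ℝ (Fin m) →L[ℝ] EuclideanSpace ℝ (Fin m)}
    {x : EuclideanSpace ℝ (Fin m)} {u : EuclideanSpace ℝ (Fin n)}
    (h : ∀ A : EuclideanSpace ℝ (Fin m) →L[ℝ] EuclideanSpace ℝ (Fin n),
      exchangeCoord Γ (exchangeCoord Γ (x, ((u, A), 0))) = (x, ((u, A), 0))) : Γ.flip = Γ := by
  ext1 v
  ext1 w
  rw [ContinuousLinearMap.flip_apply, ← sub_eq_zero]
  set d := Γ w v - Γ v w with hd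
  -- This choice gives `A d = ‖d‖² e₀`; the vector e₀ exists because `1 ≤ n`.
  let A : EuclideanSpace ℝ (Fin m) →L[ℝ] EuclideanSpace ℝ (Fin n) :=
    (innerSL ℝ d).smulRight (EuclideanSpace.single ⟨0, hn⟩ 1)
  have h1 := congrArg (fun y => (y.2.2 w).2 v) (h A)
  have h2 : A d = 0 := by
    rw [hd, map_sub]
    simp only [exchangeCoord] at h1
    simpa [sub_eq_add_neg, add_comm] using h1
  have h3 := congrArg (fun s => s ⟨0, hn⟩) h2
  simpa [A] using h3

theorem torsion_eq_zero_of_involutive (h : IsExchangeMap cov ex) (hn : 1 ≤ n)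
    (hinv : ∀ w, ex (ex w) = w) : cov.torsion = 0 := by
  funext x
  obtain ⟨p, rfl⟩ := IsFibration.surjective (X := EuclideanSpace ℝ (Fin m))
    (F := EuclideanSpace ℝ (Fin n)) (π := π) x
  obtain ⟨c, hc⟩ := IsFibration.exists_fiberedChart (X := EuclideanSpace ℝ (Fin m))
    (F := EuclideanSpace ℝ (Fin n)) (π := π) p
  refine (torsion_eq_zero_iff_christoffelMap cov c.base_mem (c.mapsTo _ hc)).2 ?_
  refine flip_eq_of_exchangeCoord_involutive hn (x := (c.total p).1) (u := (c.total p).2)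
    fun A => ?_
  have ht : ((c.total p).1, ((c.total p).2, A)) ∈ c.jet.total.target := c.total.map_source hc
  -- Every `A` occurs, with `B = 0`, as coordinates of an iterated jet over `p`; surjectivity of `π`
  -- yields such a `p` over each `x`.
  have hy := c.jet.jetCoord_jetOfCoord (y := ((c.total p).1, (((c.total p).2, A), 0))) ht
  have hpt : (c.jet.jetOfCoord ((c.total p).1, (((c.total p).2, A), 0))).pt.pt = p := by
    rw [c.jet.jetOfCoord_pt]
    refine (c.jetOfCoord_pt ((c.total p).1, ((c.total p).2, A))).trans ?_
    exact c.total.left_inv hc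
  set w := c.jet.jetOfCoord ((c.total p).1, (((c.total p).2, A), 0))
  obtain ⟨k₁, e₁⟩ := isExchangeMap_iff.1 h c w (by rwa [hpt])
  obtain ⟨k₂, e₂⟩ := isExchangeMap_iff.1 h c (ex w) k₁
  rw [hinv, e₁, h.pt_pt, hpt, hy] at e₂
  exact e₂.symm

end ExchangeAffine

/-! ### Smoothness of the symbols of ∇ + T. -/

section Smoothness

variable {m : ℕ} {M : Type*} [TopologicalSpace M] [ChartedSpace (EuclideanSpace ℝ (Fin m)) M]
  [IsManifold 𝓘(ℝ, EuclideanSpace ℝ (Fin m)) ∞ M]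
  {φ : OpenPartialHomeomorph M (EuclideanSpace ℝ (Fin m))}

theorem contDiff_flip {X Y Z : Type*} [NormedAddCommGroup X] [NormedSpace ℝ X]
    [NormedAddCommGroup Y] [NormedSpace ℝ Y] [NormedAddCommGroup Z] [NormedSpace ℝ Z] {k : ℕ∞ω} :
    ContDiff ℝ k (fun L : X →L[ℝ] Y →L[ℝ] Z => L.flip) :=
  IsBoundedLinearMap.contDiff ⟨⟨fun _ _ => rfl, fun _ _ => rfl⟩, 1, one_pos, fun L => by
    rw [one_mul, ContinuousLinearMap.opNorm_flip]⟩

theorem contMDiffOn_christoffelMap_addTorsion [T2Space M] (cov : LinearConnection m M)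
    [cov.ContMDiffCovariantDerivative ∞]
    (hφ : φ ∈ IsManifold.maximalAtlas 𝓘(ℝ, EuclideanSpace ℝ (Fin m)) ∞ M) :
    ContMDiffOn 𝓘(ℝ, EuclideanSpace ℝ (Fin m)) 𝓘(ℝ, EuclideanSpace ℝ (Fin m) →L[ℝ]
      EuclideanSpace ℝ (Fin m) →L[ℝ] EuclideanSpace ℝ (Fin m)) ∞
      (christoffelMap (addTorsion cov) φ) φ.source :=
  (contDiff_flip.contMDiff.comp_contMDiffOn (contMDiffOn_christoffelMap cov hφ)).congr
    fun _ hx => christoffelMap_addTorsion cov hφ hx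

end Smoothness

end JetExchange

end

theorem mainTheorem8 {m n : ℕ} {M : Type*} {E : Type*}
    [TopologicalSpace M] [ChartedSpace (EuclideanSpace ℝ (Fin m)) M]
    [IsManifold 𝓘(ℝ, EuclideanSpace ℝ (Fin m)) ∞ M] [T2Space M]
    [TopologicalSpace E]
    [ChartedSpace (EuclideanSpace ℝ (Fin m) × EuclideanSpace ℝ (Fin n)) E]
    [IsManifold 𝓘(ℝ, EuclideanSpace ℝ (Fin m) × EuclideanSpace ℝ (Fin n)) ∞ E]
    (π : E → M) [IsFibration (EuclideanSpace ℝ (Fin m)) (EuclideanSpace ℝ (Fin n)) π]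
    (cov : LinearConnection m M) [cov.ContMDiffCovariantDerivative ∞] :
    -- the local expression defines a unique global map
    (∃! ex : IteratedJet (EuclideanSpace ℝ (Fin m)) (EuclideanSpace ℝ (Fin n)) π →
        IteratedJet (EuclideanSpace ℝ (Fin m)) (EuclideanSpace ℝ (Fin n)) π,
      IsExchangeMap cov ex) ∧
    ∀ ex : IteratedJet (EuclideanSpace ℝ (Fin m)) (EuclideanSpace ℝ (Fin n)) π →
        IteratedJet (EuclideanSpace ℝ (Fin m)) (EuclideanSpace ℝ (Fin n)) π,
      IsExchangeMap cov ex →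
      -- it is a diffeomorphism, and its inverse is the exchange map of `∇ + T`
      (∃ Φ : IteratedJet (EuclideanSpace ℝ (Fin m)) (EuclideanSpace ℝ (Fin n)) π
          ≃ₘ^∞⟮𝓘(ℝ, IteratedJetModel m n), 𝓘(ℝ, IteratedJetModel m n)⟯
          IteratedJet (EuclideanSpace ℝ (Fin m)) (EuclideanSpace ℝ (Fin n)) π,
        ⇑Φ = ex ∧ ∀ ex', IsExchangeMap (addTorsion cov) ex' ↔ ex' = ⇑Φ.symm) ∧
      -- it exchanges the two projections `(π₁)_{1,0}` and `j¹(π_{1,0})` onto `J¹π`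
      (∀ w, (ex w).prolong = w.pt) ∧
      (∀ w, (ex w).pt = w.prolong) ∧
      -- it exchanges the affine structures of the fibres of the two projections
      (∀ (t : ℝ) w₀ w₁ w, Jet1.IsAffineComb t w₀ w₁ w ↔
        IteratedJet.IsProlongedAffineComb t (ex w₀) (ex w₁) (ex w)) ∧
      (∀ (t : ℝ) w₀ w₁ w, IteratedJet.IsProlongedAffineComb t w₀ w₁ w ↔
        Jet1.IsAffineComb t (ex w₀) (ex w₁) (ex w)) ∧
      -- it is an involution if and only if `∇` is symmetric
      (1 ≤ n → (ex ∘ ex = id ↔ cov.torsion = 0)) := by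
  refine ⟨existsUnique_isExchangeMap (n := n) π cov, fun ex h => ?_⟩
  obtain ⟨ex', h', huniq⟩ := existsUnique_isExchangeMap (n := n) π (addTorsion cov)
  have hl : ∀ w, ex' (ex w) = w := fun w => (h.addTorsion_comp h' w).1
  have hr : ∀ w, ex (ex' w) = w := fun w => (h.addTorsion_comp h' w).2
  refine ⟨⟨⟨⟨ex, ex', hl, hr⟩, h.contMDiff fun φ hφ => contMDiffOn_christoffelMap cov hφ,
    h'.contMDiff fun φ hφ => contMDiffOn_christoffelMap_addTorsion cov hφ⟩, rfl,
    fun ex'' => ⟨huniq ex'', fun e => e ▸ h'⟩⟩, h.prolong_eq_pt, h.pt_eq_prolong,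
    fun t w₀ w₁ w => ⟨h.isProlongedAffineComb, fun H => ?_⟩,
    fun t w₀ w₁ w => ⟨h.isAffineComb, fun H => ?_⟩, fun hn => ⟨fun hinv => ?_, fun hT => ?_⟩⟩
  -- The converse directions follow by applying the inverse, itself the exchange map of ∇ + T, to
  -- the images.
  · simpa only [hl] using h'.isAffineComb H
  · simpa only [hl] using h'.isProlongedAffineComb H
  · exact torsion_eq_zero_of_involutive h hn (congrFun hinv)
  · exact funext fun w =>
      (h.addTorsion_comp (isExchangeMap_addTorsion_of_torsion_eq_zero h hT) w).1
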